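/- Let $\mathcal U$ be a nonempty finite set of size $n$, let $f:2^{\mathcal U}\to\mathbb R_{\ge 0}$ be submodular (not necessarily monotone), given by a value oracle, and let $\mathcal I$ be either a size constraint $\{S:|S|\le k\}$ or the family of independent sets of a matroid of rank $k$ on $\mathcal U$. Let $O$ maximize $f$ over $\mathcal I$, and assume $f(O)>0$. Add $3k$ dummy elements to $\mathcal U$, which do not change the value of $f$; a set of true and dummy elements is feasible if its true part lies in $\mathcal I$ and its total size is at most $k$, and a basis is a maximal feasible set. Write $\Delta(x\mid S)=f(S\cup\{x\})-f(S)$. Let $\varepsilon>0$, $t\in[0,1]$, and let $Z_0\in\mathcal I$ satisfy $f(Z_0)\ge\alpha_0 f(O)$ for a constant $\alpha_0>0$. Consider the following algorithm. (1) FastLS: let $Z$ be $Z_0$ filled up with dummy elements to size $k$. While there are $a\in Z$ and $e\notin Z$ such that $Z-a+e$ is feasible and $\Delta(e\mid Z)-\Delta(a\mid Z\setminus\{a\})\ge\frac{\varepsilon}{k}f(Z)$, replace $Z$ by $Z-a+e$ for some such pair. (2) GuidedRG: let $A_0$ consist of $k$ dummy elements. For $i=1,\dots,k$, let $M_i$ be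 a basis that maximizes $\sum_{x\in M}\Delta(x\mid A_{i-1})$ among the bases $M$ disjoint from $A_{i-1}\cup Z$ if $i\le tk$, and among the bases $M$ disjoint from $A_{i-1}$ if $i>tk$. Draw $x_i\in M_i$ uniformly at random. Under a size constraint, let $A_i=A_{i-1}+x_i-e_0$ for a dummy element $e_0\in A_{i-1}$; under a matroid constraint, choose, before $x_i$ is drawn, a bijection $\sigma_i:M_i\to A_{i-1}$ such that $A_{i-1}+x-\sigma_i(x)$ is feasible for all $x\in M_i$, and let $A_i=A_{i-1}+x_i-\sigma_i(x_i)$. (3) Return whichever of the true parts of $Z$ and $A_k$ has the larger value of $f$. Suppose that $k\ge 1/\varepsilon$. Then, however the choices left open are made, all choices that the algorithm requires exist, it terminates, and it returns a set $S\in\mathcal I$ with $$\mathbb E[f(S)]\ge(0.385-\varepsilon)\,f(O)\quad\text{under a size constraint, with } t=0.372,$$ $$\mathbb E[f(S)]\ge(0.305-\varepsilon)\,f(O)\quad\text{under a matroid constraint, with } t=0.559.$$ If moreover $\varepsilon\le 1$, then the number of oracle queries is always at most $C\,kn/\varepsilon$, where $C$ depends only on $\alpha_0$. -/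

import Mathlib

universe u

/-- Randomized algorithms with access to a value oracle `Q → ℝ`, as interaction trees.
`query s next` asks for the values on the finite set `s` of arguments (this counts as `s.card`
queries) and continues with the answers, the only information about the oracle that
`next` receives.  `pick M h next` draws an element of `M` uniformly at random, independently of
all previous draws. -/
inductive OracleAlg (Q V : Type u) (β : Type u) : Type u
  | ret (b : β) : OracleAlg Q V β
  | query (s : Finset Q) (next : ((q : Q) → q ∈ s → ℝ) → OracleAlg Q V β) : OracleAlg Q V β
  | pick (M : Finset V) (h : M.Nonempty) (next : V → OracleAlg Q V β) : OracleAlg Q V β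

namespace OracleAlg

variable {Q V β γ : Type u}

/-- Sequential composition. -/
def bind : OracleAlg Q V β → (β → OracleAlg Q V γ) → OracleAlg Q V γ
  | ret b, g => g b
  | query s next, g => query s fun ans => (next ans).bind g
  | pick M h next, g => pick M h fun v => (next v).bind g

/-- Joint law of the output and of the number of oracle queries when the oracle is `f`. -/
noncomputable def run (f : Q → ℝ) : OracleAlg Q V β → PMF (β × ℕ)
  | ret b => PMF.pure (b, 0)
  | query s next => (run f (next fun q _ => f q)).map fun o => (o.1, o.2 + s.card)
  | pick M h next => (PMF.uniformOfFinset M h).bind fun v => run f (next v)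

end OracleAlg

/-- Submodularity of a set function. -/
def IsSubmodular {α : Type u} [DecidableEq α] (f : Finset α → ℝ) : Prop :=
  ∀ A B : Finset α, f (A ∪ B) + f (A ∩ B) ≤ f A + f B

/-- The two kinds of constraint: `|S| ≤ k`, and independence in a matroid. -/
inductive Constraint (α : Type u) : Type u
  | size (k : ℕ) : Constraint α
  | matroid (M : Matroid α) : Constraint α

namespace Constraint

variable {α : Type u}

/-- The number `k`: the size bound, respectively the rank of the matroid. -/
noncomputable def budget : Constraint α → ℕ
  | size k => k
  | matroid M => M.eRank.toNat

/-- Feasible subsets of the ground set. -/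
def Feasible : Constraint α → Finset α → Prop
  | size k, S => S.card ≤ k
  | matroid M, S => M.Indep (S : Set α)

/-- The ground set extended by `3k` dummy elements.  (Up to `k` of them lie in the current
solution and up to `k` in the guidance set, so that `k` are always available.) -/
abbrev Ext (c : Constraint α) : Type u := α ⊕ Fin (3 * c.budget)

/-- Feasible subsets of the extended ground set: a feasible set of true elements together with
dummy elements, of total size at most `k`. -/
def ExtFeasible (c : Constraint α) (S : Finset c.Ext) : Prop :=
  c.Feasible S.toLeft ∧ S.card ≤ c.budget

/-- Bases: the maximal feasible subsets of the extended ground set. -/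
def IsBasis (c : Constraint α) (S : Finset c.Ext) : Prop :=
  Maximal c.ExtFeasible S

/-- `k` dummy elements. -/
noncomputable def dummies (c : Constraint α) : Finset c.Ext :=
  Finset.disjSum ∅ (Finset.univ.filter fun d => d.val < c.budget)

/-- The set `Z₀`, filled up with dummy elements to size `k`. -/
noncomputable def pad (c : Constraint α) (Z₀ : Finset α) : Finset c.Ext :=
  Finset.disjSum Z₀ (Finset.univ.filter fun d => d.val < c.budget - Z₀.card)

variable [DecidableEq α]

/-- `p = (a, e)` is an admissible swap at `Z`: `a ∈ Z`, `e ∉ Z`, `Z - a + e` is feasible, and the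
weight of `e` exceeds that of `a` by at least `δ`. -/
def IsSwap (c : Constraint α) (Z : Finset c.Ext) (w : c.Ext → ℝ) (δ : ℝ) (p : c.Ext × c.Ext) :
    Prop :=
  p.1 ∈ Z ∧ p.2 ∉ Z ∧ c.ExtFeasible (insert p.2 (Z.erase p.1)) ∧ δ ≤ w p.2 - w p.1

/-- `M` is a basis inside `X` of maximum total weight. -/
def IsMaxBasis (c : Constraint α) (X : Finset c.Ext) (w : c.Ext → ℝ) (M : Finset c.Ext) : Prop :=
  c.IsBasis M ∧ M ⊆ X ∧ ∀ B, c.IsBasis B → B ⊆ X → ∑ x ∈ B, w x ≤ ∑ x ∈ M, w x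

/-- `σ x` is the element that leaves the current solution `A` when `x ∈ M` enters it.  Size
constraint: some dummy element of `A`.  Matroid constraint: `σ` is a bijection from `M` to `A`
such that each `A + x - σ x` is feasible. -/
def IsRemoval : (c : Constraint α) → (M A : Finset c.Ext) → (σ : c.Ext → c.Ext) → Prop
  | size k, M, A, σ => ∀ x ∈ M, σ x ∈ A ∧ ∃ d : Fin (3 * (size k : Constraint α).budget),
      σ x = Sum.inr d
  | matroid N, M, A, σ => Set.BijOn σ (M : Set _) (A : Set _) ∧
      ∀ x ∈ M, (matroid N).ExtFeasible (insert x (A.erase (σ x)))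

/-- A resolution of the choices which the pseudocode leaves open: which admissible swap is made,
which maximizing basis is taken, and which elements are removed.  Each rule makes a
legal choice whenever there is one. -/
structure Rules (c : Constraint α) where
  /-- the swap made at `Z`, given the weights and the threshold; `none` if there is none -/
  swap : Finset c.Ext → (c.Ext → ℝ) → ℝ → Option (c.Ext × c.Ext)
  swap_some : ∀ Z w δ p, swap Z w δ = some p → c.IsSwap Z w δ p
  swap_none : ∀ Z w δ, swap Z w δ = none → ∀ p, ¬ c.IsSwap Z w δ p
  /-- the basis chosen in iteration `i`, with current solution `A`, inside `X` -/
  basis : (i : ℕ) → (A X : Finset c.Ext) → (w : c.Ext → ℝ) → Finset c.Ext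
  basis_spec : ∀ i A X w, (∃ M, c.IsMaxBasis X w M) → c.IsMaxBasis X w (basis i A X w)
  /-- the removal map chosen in iteration `i` for the basis `M` and the current solution `A` -/
  removal : (i : ℕ) → (M A : Finset c.Ext) → (w : c.Ext → ℝ) → (c.Ext → c.Ext)
  removal_spec : ∀ i M A w, (∃ σ, c.IsRemoval M A σ) → c.IsRemoval M A (removal i M A w)

variable [Fintype α]

/-- The sets `R`, `R + x` and `R - x`, for `x` in the ground set. -/
def neighbours (R : Finset α) : Finset (Finset α) :=
  insert R (Finset.univ.image (fun x => insert x R) ∪ Finset.univ.image (fun x => R.erase x))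

/-- Query `f(S)` and all marginal gains `Δ(x | S \ {x}) = f(S + x) - f(S - x)`; dummy elements do
not change `f` and have gain `0`. -/
def marginals (c : Constraint α) (S : Finset c.Ext) :
    OracleAlg (Finset α) c.Ext (ℝ × (c.Ext → ℝ)) :=
  .query (neighbours S.toLeft) fun ans => .ret
    (ans S.toLeft (by simp [neighbours]),
      Sum.elim (fun x => ans (insert x S.toLeft) (by simp [neighbours]) -
        ans (S.toLeft.erase x) (by simp [neighbours])) (fun _ => 0))

/-- The local search: as long as an admissible swap with threshold `(ε / k) f(Z)` exists, make it.
The loop is unrolled `m` times; the output is `none` if it has not ended by then. -/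
noncomputable def fastLS {c : Constraint α} (ρ : Rules c) (ε : ℝ) :
    ℕ → Finset c.Ext → OracleAlg (Finset α) c.Ext (Option (Finset c.Ext))
  | 0, _ => .ret none
  | m + 1, Z => (c.marginals Z).bind fun r =>
      match ρ.swap Z r.2 (ε / c.budget * r.1) with
      | none => .ret (some Z)
      | some p => fastLS ρ ε m (insert p.2 (Z.erase p.1))

open Classical in
/-- Iteration `i` of the guided random greedy algorithm, with guidance set `Z`, switch time `t` and
current solution `A`. -/
noncomputable def guidedStep {c : Constraint α} (ρ : Rules c) (t : ℝ) (Z : Finset c.Ext) (i : ℕ)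
    (A : Finset c.Ext) : OracleAlg (Finset α) c.Ext (Option (Finset c.Ext)) :=
  (c.marginals A).bind fun r =>
    let X : Finset c.Ext :=
      if (i : ℝ) ≤ t * c.budget then Finset.univ \ (A ∪ Z) else Finset.univ \ A
    let M := ρ.basis i A X r.2
    let σ := ρ.removal i M A r.2
    if h : c.IsMaxBasis X r.2 M ∧ c.IsRemoval M A σ ∧ M.Nonempty then
      .pick M h.2.2 fun x => .ret (some (insert x (A.erase (σ x))))
    else .ret none

/-- The first `j` iterations of the guided random greedy algorithm, started from `k` dummy
elements. -/
noncomputable def guidedRG {c : Constraint α} (ρ : Rules c) (t : ℝ) (Z : Finset c.Ext) :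
    ℕ → OracleAlg (Finset α) c.Ext (Option (Finset c.Ext))
  | 0 => .ret (some c.dummies)
  | j + 1 => (guidedRG ρ t Z j).bind fun o =>
      match o with
      | none => .ret none
      | some A => guidedStep ρ t Z (j + 1) A

/-- The better of the true parts of `Z` and `A`. -/
noncomputable def better (c : Constraint α) (Z A : Finset c.Ext) :
    OracleAlg (Finset α) c.Ext (Option (Finset α)) :=
  .query {Z.toLeft, A.toLeft} fun ans => .ret <| some <|
    if ans A.toLeft (by simp) ≤ ans Z.toLeft (by simp) then Z.toLeft else A.toLeft

/-- The combined algorithm: local search from `Z₀`, then `k` iterations of guided random greedy,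
then the better of the two solutions.  The loop of the local search is unrolled `m` times; the
output is `none` if it has not ended by then, or if a required choice does not exist. -/
noncomputable def localSearchGuidedGreedy {c : Constraint α} (ρ : Rules c) (ε t : ℝ)
    (Z₀ : Finset α) (m : ℕ) : OracleAlg (Finset α) c.Ext (Option (Finset α)) :=
  (fastLS ρ ε m (c.pad Z₀)).bind fun o =>
    match o with
    | none => .ret none
    | some Z => (guidedRG ρ t Z c.budget).bind fun o' =>
        match o' with
        | none => .ret none
        | some A => c.better Z A

/-- Expectation of `f` at the output, for a joint law of the output and the query count (a missing
output contributes `0`). -/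
noncomputable def expectedValue (f : Finset α → ℝ) (μ : PMF (Option (Finset α) × ℕ)) : ℝ :=
  ∑ S : Finset α, ((μ.map Prod.fst) (some S)).toReal * f S

/-- On the instance `(f, c)`, with accuracy `ε`, switch time `t`, every `α₀`-approximate
starting set and every resolution of the open choices, the algorithm halts, always outputs a
feasible set, has expected value at least `r` times the optimum, and, if `ε ≤ 1`, always
makes at most `C k n / ε` oracle queries. -/
def Guarantee (c : Constraint α) (f : Finset α → ℝ) (α₀ ε t r C : ℝ) : Prop :=
  ∀ (ρ : Rules c) (Z₀ O : Finset α),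
    c.Feasible O → (∀ S, c.Feasible S → f S ≤ f O) → 0 < f O →
    c.Feasible Z₀ → α₀ * f O ≤ f Z₀ →
    ∃ N : ℕ, ∀ m ≥ N,
      (∀ o ∈ ((localSearchGuidedGreedy ρ ε t Z₀ m).run f).support,
        (∃ S, o.1 = some S ∧ c.Feasible S) ∧
        (ε ≤ 1 → (o.2 : ℝ) ≤ C * (c.budget * Fintype.card α / ε))) ∧
      r * f O ≤ expectedValue f ((localSearchGuidedGreedy ρ ε t Z₀ m).run f)

end Constraint

/-! A local optimum `Z` either is already good enough or is a useful set to avoid. Pairing `Z` with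
a feasible set by a bijective exchange and summing the failed swap inequalities
(`le_of_forall_not_isSwap`) gives, up to ε f(Z), f(Z ∩ O) ≤ f(Z) and f(Z ∩ O) + f(Z ∪ O) ≤ 2 f(Z).
So if f(Z) is below the target value, both f(Z ∩ O) and f(Z ∪ O) are small.

While the greedy solution A stays disjoint from Z, submodularity keeps f(O ∪ A) ≥ f(O) − f(O ∪ Z),
and f(O \ Z) ≥ f(O) − f(Z ∩ O). The first phase therefore aims at O \ Z, and the second,
unrestricted, at O. Write u, a, b for the means of f(A), f(O ∪ A), f((O \ Z) ∪ A). Each iteration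
yields linear inequalities with ratio r = 1 − l/k: u is fed by b/k in the first phase and by a/k in
the second, while a and b shrink slowly. Here l = 1 if only dummies leave the solution, and l = 2
for a matroid, where the expected removal loss costs another f(A)/k.

Solving these recursions (`two_phase_recursion_le`) bounds the final mean below by K f(O) − cW f(Z ∩
O) − cY f(O ∪ Z). Inserting the two local search bounds (`le_of_local_optimum`) leaves one numerical
inequality for each constraint; since 1/k ≤ ε, the error of replacing powers of r by exponentials is
absorbed by ε.

The local search ends because every swap multiplies f(Z) by at least 1 + ε/k, and f(Z) ≤ f(O) ≤
f(Z₀)/α₀. -/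

namespace OracleAlg

/-! ### Expectations and sure properties of oracle algorithms. -/

variable {Q V β γ : Type u}

/-- Expectation of `h` at the output when the oracle is `f`. -/
noncomputable def expect (f : Q → ℝ) : OracleAlg Q V β → (β → ℝ) → ℝ
  | ret b, h => h b
  | query _ next, h => expect f (next fun q _ => f q) h
  | pick M _ next, h => (M.card : ℝ)⁻¹ * ∑ v ∈ M, expect f (next v) h

/-- Every possible output, with the number of queries made, satisfies `P` when the oracle is `f`. -/
def Always (f : Q → ℝ) : OracleAlg Q V β → (β → ℕ → Prop) → Prop
  | ret b, P => P b 0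
  | query s next, P => Always f (next fun q _ => f q) fun b n => P b (n + s.card)
  | pick M _ next, P => ∀ v ∈ M, Always f (next v) P

theorem always_iff_support (f : Q → ℝ) (x : OracleAlg Q V β) (P : β → ℕ → Prop) :
    x.Always f P ↔ ∀ o ∈ (x.run f).support, P o.1 o.2 := by
  induction x generalizing P with
  | ret b => simp [Always, run]
  | query s next ih =>
    simp only [Always, run, ih, PMF.support_map, Set.forall_mem_image]
  | pick M h next ih =>
    simp only [Always, run, ih, PMF.mem_support_bind_iff, PMF.mem_support_uniformOfFinset_iff]
    exact ⟨fun H o ⟨v, hv, ho⟩ => H v hv o ho, fun H v hv o ho => H o ⟨v, hv, ho⟩⟩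

theorem always_bind (f : Q → ℝ) (x : OracleAlg Q V β) (g : β → OracleAlg Q V γ)
    (P : γ → ℕ → Prop) :
    (x.bind g).Always f P ↔
      x.Always f fun b n => (g b).Always f fun d m => P d (m + n) := by
  induction x generalizing P with
  | ret b => simp [Always, bind]
  | query s next ih => simp only [Always, bind, ih, add_assoc]
  | pick M h next ih => simp only [Always, bind, ih]

theorem Always.mono {f : Q → ℝ} {x : OracleAlg Q V β} {P P' : β → ℕ → Prop}
    (hx : x.Always f P) (h : ∀ b n, P b n → P' b n) : x.Always f P' := by
  rw [always_iff_support] at *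
  exact fun o ho => h _ _ (hx o ho)

theorem expect_bind (f : Q → ℝ) (x : OracleAlg Q V β) (g : β → OracleAlg Q V γ) (h : γ → ℝ) :
    (x.bind g).expect f h = x.expect f fun b => (g b).expect f h := by
  induction x with
  | ret b => simp [expect, bind]
  | query s next ih => simp only [expect, bind, ih]
  | pick M hM next ih => simp only [expect, bind, ih]

theorem expect_mono {f : Q → ℝ} {x : OracleAlg Q V β} {h h' : β → ℝ}
    (H : x.Always f fun b _ => h b ≤ h' b) : x.expect f h ≤ x.expect f h' := by
  induction x with
  | ret b => exact H
  | query s next ih => exact ih _ H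
  | pick M hM next ih =>
    exact mul_le_mul_of_nonneg_left (Finset.sum_le_sum fun v hv => ih v (H v hv)) (by positivity)

theorem expect_const (f : Q → ℝ) (x : OracleAlg Q V β) (a : ℝ) :
    x.expect f (fun _ => a) = a := by
  induction x with
  | ret b => rfl
  | query s next ih => exact ih _
  | pick M hM next ih =>
    have : (M.card : ℝ) ≠ 0 := by exact_mod_cast hM.card_pos.ne'
    simp [expect, ih, this]

theorem expect_add (f : Q → ℝ) (x : OracleAlg Q V β) (h h' : β → ℝ) :
    x.expect f (fun b => h b + h' b) = x.expect f h + x.expect f h' := by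
  induction x with
  | ret b => rfl
  | query s next ih => exact ih _
  | pick M hM next ih => simp only [expect, ih, Finset.sum_add_distrib, mul_add]

theorem expect_const_mul (f : Q → ℝ) (x : OracleAlg Q V β) (a : ℝ) (h : β → ℝ) :
    x.expect f (fun b => a * h b) = a * x.expect f h := by
  induction x with
  | ret b => rfl
  | query s next ih => exact ih _
  | pick M hM next ih =>
    simp only [expect, ih, ← Finset.mul_sum]
    ring

theorem le_expect {f : Q → ℝ} {x : OracleAlg Q V β} {h : β → ℝ} {a : ℝ}
    (H : x.Always f fun b _ => a ≤ h b) : a ≤ x.expect f h :=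
  (expect_const f x a).symm.le.trans (expect_mono H)

/-- Links the recursive `expect` to the law `run`, so that all estimates can be made without `PMF`.
-/
theorem sum_run_map_fst [Fintype V] [Fintype β] (f : Q → ℝ) (x : OracleAlg Q V β) (h : β → ℝ) :
    ∑ b, (((x.run f).map Prod.fst) b).toReal * h b = x.expect f h := by
  classical
  induction x with
  | ret b =>
    simp only [run, PMF.pure_map, expect]
    rw [Finset.sum_eq_single b] <;> simp +contextual [PMF.pure_apply]
  | query s next ih =>
    simp only [run, PMF.map_comp, expect, ← ih]
    rfl
  | pick M hM next ih =>
    simp only [run, PMF.map_bind, expect, ← ih, PMF.bind_apply, tsum_fintype]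
    have key : ∀ b, (∑ v, (PMF.uniformOfFinset M hM) v *
        ((next v).run f |>.map Prod.fst) b).toReal =
        ∑ v ∈ M, (M.card : ℝ)⁻¹ * (((next v).run f |>.map Prod.fst) b).toReal := by
      intro b
      rw [ENNReal.toReal_sum fun v _ => ENNReal.mul_ne_top (PMF.apply_ne_top _ _)
        (PMF.apply_ne_top _ _), ← Finset.sum_subset (Finset.subset_univ M)]
      · refine Finset.sum_congr rfl fun v hv => ?_
        simp [PMF.uniformOfFinset_apply, hv]
      · intro v _ hv
        simp [PMF.uniformOfFinset_apply, hv]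
    simp only [key, Finset.sum_mul, Finset.mul_sum]
    rw [Finset.sum_comm]
    simp only [mul_assoc]

end OracleAlg

/-! ### Inequalities for submodular functions. -/

section SetFunction

variable {V : Type u} [DecidableEq V] {g : Finset V → ℝ}

theorem IsSubmodular.sub_le_sum_insert (hg : IsSubmodular g) (S M : Finset V) :
    g (S ∪ M) - g S ≤ ∑ x ∈ M, (g (insert x S) - g S) := by
  induction M using Finset.induction_on with
  | empty => simp
  | insert x M hx ih =>
    rw [Finset.sum_insert hx]
    have h := hg (insert x S) (S ∪ M)
    have h1 : insert x S ∪ (S ∪ M) = S ∪ insert x M := by ext y; simp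
    rw [h1] at h
    by_cases hxS : x ∈ S
    · have h2 : S ∪ insert x M = S ∪ M := by ext y; simp; grind
      simp only [h2, Finset.insert_eq_of_mem hxS]
      linarith
    · have h2 : insert x S ∩ (S ∪ M) = S := by ext y; simp; grind
      rw [h2] at h
      linarith

theorem IsSubmodular.sum_erase_le (hg : IsSubmodular g) (S R : Finset V) :
    ∑ a ∈ R, (g S - g (S.erase a)) ≤ g S - g (S \ R) := by
  induction R using Finset.induction_on with
  | empty => simp
  | insert a R ha ih =>
    rw [Finset.sum_insert ha]
    by_cases haS : a ∈ S
    · have h := hg (S.erase a) (S \ R)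
      have h1 : S.erase a ∪ (S \ R) = S := by ext y; simp; grind
      have h2 : S.erase a ∩ (S \ R) = S \ insert a R := by ext y; simp; grind
      rw [h1, h2] at h
      linarith
    · have h2 : S \ insert a R = S \ R := by ext y; simp; grind
      simp only [h2, Finset.erase_eq_of_notMem haS]
      linarith

/-- Submodularity for O ∪ T and O ∪ Z, which meet exactly in O; their union has nonnegative value.
This is the gain from avoiding Z. -/
theorem IsSubmodular.le_union_of_disjoint (hg : IsSubmodular g) (h0 : ∀ S, 0 ≤ g S)
    {O Z T : Finset V} (hT : Disjoint T Z) : g O - g (O ∪ Z) ≤ g (O ∪ T) := by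
  have h := hg (O ∪ T) (O ∪ Z)
  have h2 : (O ∪ T) ∩ (O ∪ Z) = O := by
    rw [← Finset.union_inter_distrib_left, Finset.disjoint_iff_inter_eq_empty.1 hT,
      Finset.union_empty]
  rw [h2] at h
  linarith [h0 (O ∪ T ∪ (O ∪ Z))]

theorem IsSubmodular.sub_inter_le_sdiff (hg : IsSubmodular g) (h0 : ∀ S, 0 ≤ g S)
    (O Z : Finset V) : g O - g (Z ∩ O) ≤ g (O \ Z) := by
  have h := hg (O \ Z) (Z ∩ O)
  have h2 : O \ Z ∪ Z ∩ O = O := by ext y; simp; tauto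
  rw [h2] at h
  linarith [h0 (O \ Z ∩ (Z ∩ O))]

theorem IsSubmodular.toLeft {β : Type*} [DecidableEq β] (hg : IsSubmodular g)
    (B : Finset V) : ∀ S T : Finset (V ⊕ β), g (B ∪ (S ∪ T).toLeft) + g (B ∪ (S ∩ T).toLeft) ≤
      g (B ∪ S.toLeft) + g (B ∪ T.toLeft) := by
  intro S T
  have h := hg (B ∪ S.toLeft) (B ∪ T.toLeft)
  rwa [← Finset.union_inter_distrib_left, ← Finset.union_union_distrib_left,
    ← Finset.toLeft_union, ← Finset.toLeft_inter] at h

end SetFunction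

/-! ### The extended constraint: augmentation and exchange. -/

namespace Constraint

variable {α : Type u} {c : Constraint α}

theorem Feasible.mono {S T : Finset α} (hT : c.Feasible T) (h : S ⊆ T) : c.Feasible S := by
  cases c with
  | size k => exact (Finset.card_le_card h).trans hT
  | matroid M => exact Matroid.Indep.subset hT (by exact_mod_cast h)

theorem Feasible.augment [DecidableEq α] {I J : Finset α} (hI : c.Feasible I)
    (hJ : c.Feasible J) (h : I.card < J.card) : ∃ e ∈ J, e ∉ I ∧ c.Feasible (insert e I) := by
  cases c with
  | size k =>
    obtain ⟨e, he, heI⟩ := Finset.exists_mem_notMem_of_card_lt_card h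
    refine ⟨e, he, heI, ?_⟩
    have hJ' : J.card ≤ k := hJ
    change (insert e I).card ≤ k
    rw [Finset.card_insert_of_notMem heI]
    omega
  | matroid M =>
    obtain ⟨e, he, heI, hi⟩ := Matroid.Indep.augment_finset (M := M) hI hJ h
    exact ⟨e, he, heI, by simpa [Feasible] using hi⟩

theorem Feasible.card_le [Finite α] {S : Finset α} (hS : c.Feasible S) : S.card ≤ c.budget := by
  cases c with
  | size k => exact hS
  | matroid M =>
    have h := Matroid.Indep.encard_le_eRank (M := M) hS
    have h2 : M.eRank ≠ ⊤ := (Matroid.eRank_ne_top_iff M).2 inferInstance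
    rw [Set.encard_coe_eq_coe_finsetCard] at h
    exact ENat.natCast_le_natCast.1 (h.trans_eq (ENat.natCast_toNat h2).symm)

theorem feasible_empty {S : Finset α} (hS : c.Feasible S) : c.Feasible ∅ :=
  hS.mono (Finset.empty_subset S)

theorem ExtFeasible.mono {S T : Finset c.Ext} (hT : c.ExtFeasible T) (h : S ⊆ T) :
    c.ExtFeasible S :=
  ⟨hT.1.mono (Finset.toLeft_subset_toLeft h), (Finset.card_le_card h).trans hT.2⟩

theorem exists_inr_notMem (c : Constraint α) [DecidableEq α] (X : Finset c.Ext)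
    (m : ℕ) (h : m + X.card ≤ 3 * c.budget) :
    ∃ D : Finset (Fin (3 * c.budget)), D.card = m ∧ ∀ d ∈ D, Sum.inr d ∉ X := by
  have h1 : m ≤ (Finset.univ \ X.toRight).card := by
    have := Finset.le_card_sdiff X.toRight (Finset.univ : Finset (Fin (3 * c.budget)))
    have h2 := Finset.card_toRight_le (u := X)
    simp only [Finset.card_univ, Fintype.card_fin] at this
    omega
  obtain ⟨D, hD, hc⟩ := Finset.exists_subset_card_eq h1
  refine ⟨D, hc, fun d hd => ?_⟩
  have := hD hd
  simpa using this

theorem isBasis_iff [DecidableEq α] {S : Finset c.Ext} :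
    c.IsBasis S ↔ c.ExtFeasible S ∧ S.card = c.budget := by
  constructor
  · intro h
    refine ⟨h.1, h.1.2.antisymm ?_⟩
    by_contra! hlt
    obtain ⟨D, hD, hd⟩ := exists_inr_notMem c S 1 (by omega)
    obtain ⟨d, rfl⟩ := Finset.card_eq_one.1 hD
    have hdS := hd d (by simp)
    have hf : c.ExtFeasible (insert (Sum.inr d) S) := by
      refine ⟨by simpa using h.1.1, ?_⟩
      rw [Finset.card_insert_of_notMem hdS]
      exact hlt
    exact hdS (h.2 hf (Finset.subset_insert _ _) (Finset.mem_insert_self _ _))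
  · rintro ⟨h, hc⟩
    refine ⟨h, fun T hT hST => ?_⟩
    exact (Finset.eq_of_subset_of_card_le hST (hT.2.trans hc.ge)).symm.subset

/-- This is where 3k dummies are needed: a set `X` of size at most 2k, such as A ∪ Z, leaves k of
them unused. -/
theorem exists_basis_toLeft_eq [Finite α] [DecidableEq α] {B : Finset α} (hB : c.Feasible B)
    (X : Finset c.Ext) (hX : X.card ≤ 2 * c.budget) :
    ∃ B' : Finset c.Ext, c.ExtFeasible B' ∧ B'.card = c.budget ∧ B'.toLeft = B ∧
      ∀ d, Sum.inr d ∈ B' → Sum.inr d ∉ X := by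
  have hc := hB.card_le
  obtain ⟨D, hD, hd⟩ := exists_inr_notMem c X (c.budget - B.card) (by omega)
  have hcard : (B.disjSum D).card = c.budget := by
    rw [Finset.card_disjSum]; omega
  refine ⟨B.disjSum D, ⟨by simpa using hB, hcard.le⟩, hcard, by simp, fun d h => hd d ?_⟩
  simpa using h

/-- The larger set has more true elements or more dummies. True elements augment by the original
constraint, and dummies are restricted only by the total size. -/
theorem ExtFeasible.augment [DecidableEq α] {I J : Finset c.Ext} (hI : c.ExtFeasible I)
    (hJ : c.ExtFeasible J) (h : I.card < J.card) :
    ∃ e ∈ J, e ∉ I ∧ c.ExtFeasible (insert e I) := by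
  have key : ∀ e ∉ I, (insert e I).card ≤ c.budget := fun e he => by
    rw [Finset.card_insert_of_notMem he]
    exact h.trans_le hJ.2
  rcases lt_or_ge I.toLeft.card J.toLeft.card with hl | hl
  · obtain ⟨e, he, heI, hf⟩ := hI.1.augment hJ.1 hl
    have heI' : Sum.inl e ∉ I := by simpa using heI
    exact ⟨Sum.inl e, by simpa using he, heI', by simpa using hf, key _ heI'⟩
  · have h1 := Finset.card_toLeft_add_card_toRight (u := I)
    have h2 := Finset.card_toLeft_add_card_toRight (u := J)
    obtain ⟨e, he, heI⟩ := Finset.exists_mem_notMem_of_card_lt_card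
      (show I.toRight.card < J.toRight.card by omega)
    have heI' : Sum.inr e ∉ I := by simpa using heI
    exact ⟨Sum.inr e, by simpa using he, heI', by simpa using hI.1, key _ heI'⟩

theorem ExtFeasible.exists_extend [DecidableEq α] {I A : Finset c.Ext} (hI : c.ExtFeasible I)
    (hA : c.ExtFeasible A) (h : I.card ≤ A.card) :
    ∃ K, I ⊆ K ∧ K ⊆ I ∪ A ∧ K.card = A.card ∧ c.ExtFeasible K := by
  induction hm : A.card - I.card generalizing I with
  | zero => exact ⟨I, subset_rfl, Finset.subset_union_left, by omega, hI⟩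
  | succ m ih =>
    obtain ⟨e, he, heI, hf⟩ := hI.augment hA (by omega)
    have hc := Finset.card_insert_of_notMem heI
    obtain ⟨K, h1, h2, h3, h4⟩ := ih hf (by omega) (by omega)
    refine ⟨K, (Finset.subset_insert _ _).trans h1, h2.trans ?_, h3, h4⟩
    intro y hy
    simp only [Finset.mem_union, Finset.mem_insert] at hy ⊢
    grind

/-- Brualdi's bijective exchange property. -/
theorem ExtFeasible.exists_exchange [DecidableEq α] {A M : Finset c.Ext} (hA : c.ExtFeasible A)
    (hM : c.ExtFeasible M) (h : M.card = A.card) :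
    ∃ σ : c.Ext → c.Ext, Set.BijOn σ ((M \ A : Finset c.Ext) : Set c.Ext)
      ((A \ M : Finset c.Ext) : Set c.Ext) ∧
      ∀ x ∈ M \ A, c.ExtFeasible (insert x (A.erase (σ x))) := by
  classical
  let N : {x // x ∈ M \ A} → Finset c.Ext := fun x =>
    (A \ M).filter fun a => c.ExtFeasible (insert x.1 (A.erase a))
  -- Hall's condition. If `X` had too few neighbours, `X.biUnion N ∪ A ∩ M` could be augmented by
  -- some x from `X` and then extended inside A + x to a feasible K = A − a + x. This makes a a
  -- neighbour of x, although a lies outside K and all neighbours of `X` lie in K.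
  have hall : ∀ X : Finset {x // x ∈ M \ A}, X.card ≤ (X.biUnion N).card := by
    intro X
    by_contra! hlt
    let Y : Finset c.Ext := X.map (Function.Embedding.subtype _)
    have hY : Y ⊆ M \ A := by
      intro y hy
      simp only [Y, Finset.mem_map, Function.Embedding.coe_subtype] at hy
      obtain ⟨x, _, rfl⟩ := hy
      exact x.2
    have hN : X.biUnion N ⊆ A \ M := by
      intro y hy
      simp only [Finset.mem_biUnion, N, Finset.mem_filter] at hy
      obtain ⟨x, _, hy, _⟩ := hy
      exact hy
    have hYc : Y.card = X.card := Finset.card_map _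
    have hI : c.ExtFeasible (X.biUnion N ∪ A ∩ M) := hA.mono (by
      intro y hy
      rcases Finset.mem_union.1 hy with hy | hy
      · exact (Finset.mem_sdiff.1 (hN hy)).1
      · exact (Finset.mem_inter.1 hy).1)
    have hJ : c.ExtFeasible (Y ∪ A ∩ M) := hM.mono (by
      intro y hy
      rcases Finset.mem_union.1 hy with hy | hy
      · exact (Finset.mem_sdiff.1 (hY hy)).1
      · exact (Finset.mem_inter.1 hy).2)
    have hlt' : (X.biUnion N ∪ A ∩ M).card < (Y ∪ A ∩ M).card := by
      rw [Finset.card_union_of_disjoint, Finset.card_union_of_disjoint]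
      · omega
      · rw [Finset.disjoint_left]
        intro y hy
        have := Finset.mem_sdiff.1 (hY hy)
        simp [this.2]
      · rw [Finset.disjoint_left]
        intro y hy
        have := Finset.mem_sdiff.1 (hN hy)
        simp [this.2]
    obtain ⟨x, hxJ, hxI, hf⟩ := hI.augment hJ hlt'
    have hxY : x ∈ Y := by
      rcases Finset.mem_union.1 hxJ with hx | hx
      · exact hx
      · exact absurd (Finset.mem_union_right _ hx) hxI
    have hxM := Finset.mem_sdiff.1 (hY hxY)
    have hle : (insert x (X.biUnion N ∪ A ∩ M)).card ≤ A.card := by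
      rw [Finset.card_insert_of_notMem hxI]
      have := Finset.card_le_card (show Y ∪ A ∩ M ⊆ M by
        intro y hy
        rcases Finset.mem_union.1 hy with hy | hy
        · exact (Finset.mem_sdiff.1 (hY hy)).1
        · exact (Finset.mem_inter.1 hy).2)
      omega
    obtain ⟨K, hK1, hK2, hK3, hK4⟩ := hf.exists_extend hA hle
    have hxK : x ∈ K := hK1 (Finset.mem_insert_self _ _)
    have hnot : ¬ A ⊆ K := by
      intro hAK
      have : insert x A ⊆ K := Finset.insert_subset hxK hAK
      have := Finset.card_le_card this
      rw [Finset.card_insert_of_notMem hxM.2] at this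
      omega
    obtain ⟨a, haA, haK⟩ := Finset.not_subset.1 hnot
    have hKsub : K ⊆ insert x (A.erase a) := by
      intro y hy
      have hy' := hK2 hy
      have hya : y ≠ a := fun h => haK (h ▸ hy)
      simp only [Finset.mem_union, Finset.mem_insert, Finset.mem_inter] at hy'
      rcases hy' with (rfl | hy' | hy') | hy'
      · simp
      · simp [hya, (Finset.mem_sdiff.1 (hN hy')).1]
      · simp [hya, hy'.1]
      · simp [hya, hy']
    have hKeq : K = insert x (A.erase a) := by
      refine Finset.eq_of_subset_of_card_le hKsub ?_
      rw [hK3, Finset.card_insert_of_notMem (by simp [hxM.2]), Finset.card_erase_of_mem haA,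
        Nat.sub_add_cancel (Finset.card_pos.2 ⟨a, haA⟩)]
    have haM : a ∉ M := fun haM => haK (hK1 (by simp [haA, haM]))
    obtain ⟨x', hx', rfl⟩ := Finset.mem_map.1 hxY
    refine haK (hK1 (Finset.mem_insert_of_mem (Finset.mem_union_left _ ?_)))
    refine Finset.mem_biUnion.2 ⟨x', hx', ?_⟩
    simp only [N, Finset.mem_filter, Finset.mem_sdiff]
    exact ⟨⟨haA, haM⟩, hKeq ▸ hK4⟩
  obtain ⟨τ, hτ, hτN⟩ := (Finset.all_card_le_biUnion_card_iff_exists_injective N).1 hall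
  have hτ' : ∀ x, τ x ∈ A \ M ∧ c.ExtFeasible (insert x.1 (A.erase (τ x))) := fun x => by
    have := hτN x
    simp only [N, Finset.mem_filter] at this
    exact this
  let σ : c.Ext → c.Ext := fun x => if hx : x ∈ M \ A then τ ⟨x, hx⟩ else x
  have hσ : ∀ x (hx : x ∈ M \ A), σ x = τ ⟨x, hx⟩ := fun x hx => dif_pos hx
  have hmaps : Set.MapsTo σ ((M \ A : Finset c.Ext) : Set c.Ext)
      ((A \ M : Finset c.Ext) : Set c.Ext) := fun x hx => by
    rw [hσ x hx]
    exact (hτ' _).1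
  have hinj : Set.InjOn σ ((M \ A : Finset c.Ext) : Set c.Ext) := fun x hx y hy hxy => by
    rw [hσ x hx, hσ y hy] at hxy
    exact congrArg Subtype.val (hτ hxy)
  refine ⟨σ, ⟨hmaps, hinj, ?_⟩, fun x hx => ?_⟩
  · refine Finset.surjOn_of_injOn_of_card_le σ hmaps hinj ?_
    have h1 := Finset.card_sdiff_add_card_inter A M
    have h2 := Finset.card_sdiff_add_card_inter M A
    rw [Finset.inter_comm] at h2
    omega
  · rw [hσ x hx]
    exact (hτ' _).2

end Constraint

/-! ### Local search. -/

namespace Constraint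

variable {α : Type u} {c : Constraint α} [DecidableEq α]

/-- The gain `f(S + x) - f(S - x)` of `x`, as a function of the true part. -/
noncomputable def gain (f : Finset α → ℝ) (S : Finset c.Ext) (x : c.Ext) : ℝ :=
  f (insert x S).toLeft - f (S.erase x).toLeft

theorem gain_of_notMem (f : Finset α → ℝ) {S : Finset c.Ext} {x : c.Ext} (hx : x ∉ S) :
    gain f S x = f (insert x S).toLeft - f S.toLeft := by
  rw [gain, Finset.erase_eq_of_notMem hx]

theorem gain_of_mem (f : Finset α → ℝ) {S : Finset c.Ext} {x : c.Ext} (hx : x ∈ S) :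
    gain f S x = f S.toLeft - f (S.erase x).toLeft := by
  rw [gain, Finset.insert_eq_of_mem hx]

theorem sumElim_eq_gain (f : Finset α → ℝ) (S : Finset c.Ext) :
    (Sum.elim (fun x => f (insert x S.toLeft) - f (S.toLeft.erase x)) fun _ => 0 : c.Ext → ℝ) =
      gain f S := by
  funext x
  rcases x with x | d
  · have : (S.erase (Sum.inl x)).toLeft = S.toLeft.erase x := by ext y; simp
    simp [gain, this]
  · have : (S.erase (Sum.inr d)).toLeft = S.toLeft := by ext y; simp
    simp [gain, this]

theorem isSubmodular_toLeft {f : Finset α → ℝ} (hf : IsSubmodular f) (B : Finset α) :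
    IsSubmodular fun S : Finset c.Ext => f (B ∪ S.toLeft) :=
  hf.toLeft B

theorem isSubmodular_toLeft' {f : Finset α → ℝ} (hf : IsSubmodular f) :
    IsSubmodular fun S : Finset c.Ext => f S.toLeft := by
  simpa using isSubmodular_toLeft (c := c) hf ∅

/-- Removing a first can only increase the marginal gain of e, so the difference of weights measured
at Z underestimates the true improvement. -/
theorem add_le_of_isSwap {f : Finset α → ℝ} (hf : IsSubmodular f) {Z : Finset c.Ext} {δ : ℝ}
    {p : c.Ext × c.Ext} (hp : c.IsSwap Z (gain f Z) δ p) :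
    f Z.toLeft + δ ≤ f (insert p.2 (Z.erase p.1)).toLeft := by
  obtain ⟨h1, h2, -, h3⟩ := hp
  rw [gain_of_mem f h1, gain_of_notMem f h2] at h3
  have h := isSubmodular_toLeft' (c := c) hf (insert p.2 (Z.erase p.1)) Z
  have e1 : insert p.2 (Z.erase p.1) ∪ Z = insert p.2 Z := by ext y; simp; tauto
  have e2 : insert p.2 (Z.erase p.1) ∩ Z = Z.erase p.1 := by
    ext y
    simp only [Finset.mem_inter, Finset.mem_insert, Finset.mem_erase]
    grind
  rw [e1, e2] at h
  linarith

/-- Pad `B` to a basis and sum the failed swap inequalities along an exchange bijection. By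
submodularity the insertions gain at least f(Z ∪ B) − f(Z) in total, and the removals lose at most
f(Z) − f(Z ∩ B). -/
theorem le_of_forall_not_isSwap [Finite α] {f : Finset α → ℝ} (hf : IsSubmodular f)
    {Z : Finset c.Ext} (hZ : c.ExtFeasible Z) (hZc : Z.card = c.budget) {δ : ℝ} (hδ : 0 ≤ δ)
    (hno : ∀ p, ¬ c.IsSwap Z (gain f Z) δ p) {B : Finset α} (hB : c.Feasible B) :
    f (B ∪ Z.toLeft) + f (Z.toLeft ∩ B) ≤ 2 * f Z.toLeft + c.budget * δ := by
  obtain ⟨B', hB', hBc, hBl, -⟩ := exists_basis_toLeft_eq hB (∅ : Finset c.Ext) (by simp)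
  obtain ⟨σ, hσ, hσf⟩ := hZ.exists_exchange hB' (hBc.trans hZc.symm)
  have hsum : ∑ x ∈ B' \ Z, (gain f Z x - gain f Z (σ x)) ≤ c.budget * δ := by
    calc _ ≤ ∑ x ∈ B' \ Z, δ := Finset.sum_le_sum fun x hx => by
          have hσx := Finset.mem_sdiff.1 (Finset.mem_coe.1 (hσ.mapsTo hx))
          have hx' := Finset.mem_sdiff.1 hx
          by_contra! hlt
          exact hno (σ x, x) ⟨hσx.1, hx'.2, hσf x hx, hlt.le⟩
      _ = (B' \ Z).card * δ := by simp
      _ ≤ c.budget * δ := by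
          gcongr
          exact (Finset.card_le_card Finset.sdiff_subset).trans hBc.le
  rw [Finset.sum_sub_distrib, Finset.sum_nbij (t := Z \ B') (g := gain f Z) σ
    (fun x hx => hσ.mapsTo hx) hσ.injOn hσ.surjOn fun _ _ => rfl] at hsum
  have h1 := (isSubmodular_toLeft' (c := c) hf).sub_le_sum_insert Z (B' \ Z)
  have h2 := (isSubmodular_toLeft' (c := c) hf).sum_erase_le Z (Z \ B')
  rw [← Finset.sum_congr rfl fun x hx => gain_of_notMem f (Finset.mem_sdiff.1 hx).2] at h1
  rw [← Finset.sum_congr rfl fun x hx => gain_of_mem f (Finset.mem_sdiff.1 hx).1] at h2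
  simp only [Finset.union_sdiff_self_eq_union, Finset.toLeft_union, hBl] at h1
  simp only [sdiff_sdiff_right_self, Finset.inf_eq_inter, Finset.toLeft_inter, hBl] at h2
  rw [Finset.union_comm] at h1
  linarith

theorem insert_erase_card {A : Finset c.Ext} {a x : c.Ext} (ha : a ∈ A) (hx : x ∉ A) :
    (insert x (A.erase a)).card = A.card := by
  rw [Finset.card_insert_of_notMem (by simp [hx]), Finset.card_erase_of_mem ha,
    Nat.sub_add_cancel (Finset.card_pos.2 ⟨a, ha⟩)]

variable [Fintype α]

theorem card_neighbours_le [Nonempty α] (R : Finset α) :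
    (neighbours R).card ≤ 3 * Fintype.card α := by
  have h1 := Finset.card_insert_le R
    (Finset.univ.image (fun x => insert x R) ∪ Finset.univ.image (fun x => R.erase x))
  have h2 := Finset.card_union_le (Finset.univ.image (fun x => insert x R))
    (Finset.univ.image (fun x => R.erase x))
  have h3 := Finset.card_image_le (s := Finset.univ) (f := fun x => insert x R)
  have h4 := Finset.card_image_le (s := Finset.univ) (f := fun x => R.erase x)
  have h5 : 0 < Fintype.card α := Fintype.card_pos
  rw [Finset.card_univ] at h3 h4
  unfold neighbours
  omega

theorem expect_marginals_bind {β : Type u} (f : Finset α → ℝ) (S : Finset c.Ext)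
    (g : ℝ × (c.Ext → ℝ) → OracleAlg (Finset α) c.Ext β) (h : β → ℝ) :
    ((c.marginals S).bind g).expect f h = (g (f S.toLeft, gain f S)).expect f h := by
  rw [← sumElim_eq_gain]
  rfl

theorem always_marginals_bind {β : Type u} (f : Finset α → ℝ) (S : Finset c.Ext)
    (g : ℝ × (c.Ext → ℝ) → OracleAlg (Finset α) c.Ext β) (P : β → ℕ → Prop) :
    ((c.marginals S).bind g).Always f P ↔
      (g (f S.toLeft, gain f S)).Always f fun b n => P b (n + (neighbours S.toLeft).card) := by
  rw [← sumElim_eq_gain]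
  rfl

/-- The local search runs deterministically to a local optimum after at most `j` rounds. -/
theorem fastLS_spec [Nonempty α] (ρ : Rules c) {f : Finset α → ℝ} (hf : IsSubmodular f) {ε v : ℝ}
    (hε : 0 < ε) (hk : 0 < c.budget) (hv : ∀ S, c.Feasible S → f S ≤ v) (j : ℕ) :
    ∀ (m : ℕ) (Z : Finset c.Ext), j ≤ m → c.ExtFeasible Z → Z.card = c.budget →
      0 < f Z.toLeft → v < f Z.toLeft * (1 + ε / c.budget) ^ j →
    ∃ (Z' : Finset c.Ext) (q : ℕ), c.ExtFeasible Z' ∧ Z'.card = c.budget ∧ 0 < f Z'.toLeft ∧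
      (∀ p, ¬ c.IsSwap Z' (gain f Z') (ε / c.budget * f Z'.toLeft) p) ∧
      q ≤ j * (3 * Fintype.card α) ∧
      (∀ h, (fastLS ρ ε m Z).expect f h = h (some Z')) ∧
      ∀ P, (fastLS ρ ε m Z).Always f P ↔ P (some Z') q := by
  induction j with
  | zero =>
    -- With exponent 0 the hypothesis puts f(Z) above the upper bound `v`; the exponent thus counts
    -- the rounds that can still occur.
    intro m Z _ hZ _ _ hlt
    exact absurd (hv _ hZ.1) (not_le.2 (by simpa using hlt))
  | succ j ih =>
    intro m Z hjm hZ hZc hpos hlt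
    obtain ⟨m, rfl⟩ : ∃ m', m = m' + 1 := ⟨m - 1, by omega⟩
    have hn := card_neighbours_le Z.toLeft
    cases hs : ρ.swap Z (gain f Z) (ε / c.budget * f Z.toLeft) with
    | none =>
      refine ⟨Z, (neighbours Z.toLeft).card, hZ, hZc, hpos, ρ.swap_none _ _ _ hs, ?_,
        fun h => ?_, fun P => ?_⟩
      · exact hn.trans (Nat.le_mul_of_pos_left _ j.succ_pos)
      · rw [fastLS, expect_marginals_bind]
        simp [hs, OracleAlg.expect]
      · rw [fastLS, always_marginals_bind]
        simp [hs, OracleAlg.Always]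
    | some p =>
      have hp := ρ.swap_some _ _ _ _ hs
      have hge := add_le_of_isSwap hf hp
      have hc0 : (0 : ℝ) < c.budget := by exact_mod_cast hk
      have hge' : f Z.toLeft * (1 + ε / c.budget) ≤ f (insert p.2 (Z.erase p.1)).toLeft := by
        linarith
      have hpow : 0 < (1 + ε / (c.budget : ℝ)) ^ j := by positivity
      obtain ⟨Z', q, h1, h2, h3, h4, h5, h6, h7⟩ := ih m (insert p.2 (Z.erase p.1)) (by omega)
        hp.2.2.1 ((insert_erase_card hp.1 hp.2.1).trans hZc)
        (lt_of_lt_of_le (by positivity) hge')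
        (by
          rw [pow_succ'] at hlt
          nlinarith)
      refine ⟨Z', q + (neighbours Z.toLeft).card, h1, h2, h3, h4, ?_, fun h => ?_, fun P => ?_⟩
      · rw [Nat.add_mul]
        omega
      · rw [fastLS, expect_marginals_bind]
        simp only [hs]
        exact h6 h
      · rw [fastLS, always_marginals_bind]
        simp only [hs]
        exact h7 _

end Constraint

/-! ### Iterations of guided random greedy: legality and expectations. -/

namespace Constraint

variable {α : Type u} {c : Constraint α}

/-- Feasible current solutions after `j` iterations. -/
structure IsIterate (t : ℝ) (Z : Finset c.Ext) (j : ℕ) (A : Finset c.Ext) : Prop where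
  feasible : c.ExtFeasible A
  card : A.card = c.budget
  card_toLeft : A.toLeft.card ≤ j
  disjoint : (j : ℝ) ≤ t * c.budget → Disjoint A.toLeft Z.toLeft

theorem dummies_toLeft (c : Constraint α) : c.dummies.toLeft = ∅ := Finset.toLeft_disjSum

theorem isIterate_dummies {S : Finset α} (hS : c.Feasible S) (t : ℝ) (Z : Finset c.Ext) :
    IsIterate t Z 0 c.dummies := by
  have h1 := c.dummies_toLeft
  have h2 : c.dummies.card = c.budget := by
    simp only [dummies, Finset.card_disjSum, Finset.card_empty, zero_add]
    rw [Fin.card_filter_val_lt]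
    omega
  exact ⟨⟨h1 ▸ feasible_empty hS, h2.le⟩, h2, by simp [h1], by simp [h1]⟩

/-- Whether elements of the current solution other than dummies may be removed. -/
def lossFactor : Constraint α → ℝ
  | size _ => 0
  | matroid _ => 1

theorem lossFactor_nonneg (c : Constraint α) : 0 ≤ c.lossFactor := by
  cases c <;> simp [lossFactor]

variable [DecidableEq α]

theorem exists_isMaxBasis [Fintype α] {S : Finset α} (hS : c.Feasible S) {X : Finset c.Ext}
    {Y : Finset c.Ext} (hY : Y.card ≤ 2 * c.budget) (hX : ∀ x ∉ Y, x ∈ X) (w : c.Ext → ℝ) :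
    ∃ M, c.IsMaxBasis X w M := by
  classical
  obtain ⟨B, hB, hBc, hBl, hBY⟩ := exists_basis_toLeft_eq (feasible_empty hS) Y hY
  obtain ⟨M, hM, hmax⟩ := Finset.exists_max_image
    (Finset.univ.filter fun M => c.IsBasis M ∧ M ⊆ X) (fun M => ∑ x ∈ M, w x) ⟨B, by
      simp only [Finset.mem_filter, Finset.mem_univ, true_and]
      refine ⟨isBasis_iff.2 ⟨hB, hBc⟩, fun x hx => hX x ?_⟩
      rcases x with x | d
      · have : x ∈ B.toLeft := by simpa using hx
        simp [hBl] at this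
      · exact hBY d hx⟩
  simp only [Finset.mem_filter, Finset.mem_univ, true_and] at hM hmax
  exact ⟨M, hM.1, hM.2, fun B hB hBX => hmax B ⟨hB, hBX⟩⟩

/-- For a size constraint, `hlt` guarantees that A still contains a dummy; it holds because each
iteration adds at most one true element. For a matroid the exchange bijection serves. -/
theorem exists_isRemoval {A M : Finset c.Ext} (hA : c.ExtFeasible A)
    (hAc : A.card = c.budget) (hM : c.IsBasis M) (hMA : Disjoint M A)
    (hlt : A.toLeft.card < c.budget) : ∃ σ, c.IsRemoval M A σ := by
  cases c with
  | size k =>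
    have h := Finset.card_toLeft_add_card_toRight (u := A)
    obtain ⟨d, hd⟩ := Finset.card_pos.1 (show 0 < A.toRight.card by omega)
    exact ⟨fun _ => Sum.inr d, fun x _ => ⟨by simpa using hd, d, rfl⟩⟩
  | matroid N =>
    obtain ⟨hMf, hMc⟩ := isBasis_iff.1 hM
    obtain ⟨σ, h1, h2⟩ := hA.exists_exchange hMf (hMc.trans hAc.symm)
    rw [Finset.sdiff_eq_self_of_disjoint hMA, Finset.sdiff_eq_self_of_disjoint hMA.symm] at h1
    rw [Finset.sdiff_eq_self_of_disjoint hMA] at h2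
    exact ⟨σ, h1, h2⟩

theorem IsRemoval.mem {A M : Finset c.Ext} {σ : c.Ext → c.Ext} (h : c.IsRemoval M A σ)
    {x : c.Ext} (hx : x ∈ M) : σ x ∈ A := by
  cases c with
  | size k => exact (h x hx).1
  | matroid N => exact h.1.mapsTo hx

theorem IsRemoval.extFeasible {A M : Finset c.Ext} {σ : c.Ext → c.Ext} (h : c.IsRemoval M A σ)
    (hA : A.card = c.budget) {x : c.Ext} (hx : x ∈ M) (hxA : x ∉ A) :
    c.ExtFeasible (insert x (A.erase (σ x))) := by
  have hc := (insert_erase_card (h.mem hx) hxA).trans hA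
  cases c with
  | size k => exact ⟨(Finset.card_toLeft_le).trans hc.le, hc.le⟩
  | matroid N => exact h.2 x hx

/-- Removing a dummy costs nothing. For a matroid, each element of A leaves for exactly one x, and
by submodularity the separate losses sum to at most f(B ∪ A) − f(B). -/
theorem IsRemoval.le_sum {f : Finset α → ℝ} (hf : IsSubmodular f) {A M : Finset c.Ext}
    {σ : c.Ext → c.Ext} (h : c.IsRemoval M A σ) (hMA : Disjoint M A) (B : Finset α) :
    M.card * f (B ∪ A.toLeft) + ∑ x ∈ M, (f (B ∪ (insert x A).toLeft) - f (B ∪ A.toLeft)) -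
        c.lossFactor * (f (B ∪ A.toLeft) - f B) ≤
      ∑ x ∈ M, f (B ∪ (insert x (A.erase (σ x))).toLeft) := by
  cases c with
  | size k =>
    have : ∀ x ∈ M, (insert x (A.erase (σ x))).toLeft = (insert x A).toLeft := fun x hx => by
      obtain ⟨d, hd⟩ := (h x hx).2
      rw [hd]
      ext y
      simp
    have h2 : ∑ x ∈ M, f (B ∪ (insert x (A.erase (σ x))).toLeft) =
        ∑ x ∈ M, f (B ∪ (insert x A).toLeft) :=
      Finset.sum_congr rfl fun x hx => by rw [this x hx]
    simp [lossFactor, h2]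
  | matroid N =>
    have h1 : ∀ x ∈ M, f (B ∪ A.toLeft) + (f (B ∪ (insert x A).toLeft) - f (B ∪ A.toLeft)) -
        (f (B ∪ A.toLeft) - f (B ∪ (A.erase (σ x)).toLeft)) ≤
        f (B ∪ (insert x (A.erase (σ x))).toLeft) := fun x hx => by
      have hxA : x ∉ A := Finset.disjoint_left.1 hMA hx
      have hσ := h.1.mapsTo hx
      have := hf.toLeft B (insert x (A.erase (σ x))) A
      have e1 : insert x (A.erase (σ x)) ∪ A = insert x A := by ext y; simp; tauto
      have e2 : insert x (A.erase (σ x)) ∩ A = A.erase (σ x) := by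
        ext y
        simp only [Finset.mem_inter, Finset.mem_insert, Finset.mem_erase]
        grind
      rw [e1, e2] at this
      linarith
    have h2 := Finset.sum_le_sum h1
    rw [Finset.sum_sub_distrib, Finset.sum_add_distrib,
      Finset.sum_nbij (s := M) (t := A)
        (g := fun a => f (B ∪ A.toLeft) - f (B ∪ (A.erase a).toLeft)) σ
        (fun x hx => h.1.mapsTo hx) h.1.injOn h.1.surjOn fun _ _ => rfl] at h2
    have h3 := (isSubmodular_toLeft (c := matroid N) hf B).sum_erase_le A A
    simp only [sdiff_self, Finset.bot_eq_empty] at h3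
    have h4 : B ∪ (∅ : Finset (matroid N).Ext).toLeft = B := by ext y; simp
    rw [h4] at h3
    simp only [Finset.sum_const, nsmul_eq_mul, lossFactor, one_mul] at h2 ⊢
    linarith

variable [Fintype α]

open Classical in
/-- The elements available in iteration `i`. -/
noncomputable def candidates (t : ℝ) (Z : Finset c.Ext) (i : ℕ) (A : Finset c.Ext) :
    Finset c.Ext :=
  if (i : ℝ) ≤ t * c.budget then Finset.univ \ (A ∪ Z) else Finset.univ \ A

theorem mem_candidates {t : ℝ} {Z : Finset c.Ext} {i : ℕ} {A : Finset c.Ext} {x : c.Ext} :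
    x ∈ candidates t Z i A ↔ x ∉ A ∧ ((i : ℝ) ≤ t * c.budget → x ∉ Z) := by
  unfold candidates
  split_ifs with h <;> simp [h]

theorem disjoint_of_subset_candidates {t : ℝ} {Z : Finset c.Ext} {i : ℕ} {A M : Finset c.Ext}
    (hM : M ⊆ candidates t Z i A) : Disjoint M A :=
  Finset.disjoint_left.2 fun _ hx => (mem_candidates.1 (hM hx)).1

theorem IsIterate.succ {t : ℝ} {Z : Finset c.Ext} {j : ℕ} {A : Finset c.Ext}
    (hA : IsIterate t Z j A) {M : Finset c.Ext} {σ : c.Ext → c.Ext}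
    (hM : M ⊆ candidates t Z (j + 1) A) (hσ : c.IsRemoval M A σ) {x : c.Ext} (hx : x ∈ M) :
    IsIterate t Z (j + 1) (insert x (A.erase (σ x))) := by
  have hx' := mem_candidates.1 (hM hx)
  have hsub : (insert x (A.erase (σ x))).toLeft ⊆ (insert x A).toLeft :=
    Finset.toLeft_subset_toLeft (Finset.insert_subset_insert _ (Finset.erase_subset _ _))
  refine ⟨hσ.extFeasible hA.card hx hx'.1, (insert_erase_card (hσ.mem hx) hx'.1).trans hA.card,
    ?_, fun hj => ?_⟩
  · refine (Finset.card_le_card hsub).trans ?_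
    have := hA.card_toLeft
    rcases x with x | d
    · rw [Finset.toLeft_insert_inl]
      have := Finset.card_insert_le x A.toLeft
      omega
    · rw [Finset.toLeft_insert_inr]
      omega
  · have hd := hA.disjoint (by push_cast at hj; linarith)
    have hxZ := hx'.2 hj
    refine Finset.disjoint_of_subset_left hsub ?_
    rcases x with x | d
    · rw [Finset.toLeft_insert_inl, Finset.disjoint_insert_left]
      exact ⟨by simpa using hxZ, hd⟩
    · rwa [Finset.toLeft_insert_inr]

/-- One iteration of the guided random greedy algorithm averages over a maximal basis. -/
theorem guidedStep_spec (ρ : Rules c) (f : Finset α → ℝ) {t : ℝ} {Z : Finset c.Ext}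
    (hZc : Z.card = c.budget) {j : ℕ} (hj : j < c.budget) {A : Finset c.Ext}
    (hA : IsIterate t Z j A) :
    ∃ (M : Finset c.Ext) (σ : c.Ext → c.Ext),
      c.IsMaxBasis (candidates t Z (j + 1) A) (gain f A) M ∧ c.IsRemoval M A σ ∧
      (∀ h, (guidedStep ρ t Z (j + 1) A).expect f h =
        (c.budget : ℝ)⁻¹ * ∑ x ∈ M, h (some (insert x (A.erase (σ x))))) ∧
      ∀ P, (guidedStep ρ t Z (j + 1) A).Always f P ↔
        ∀ x ∈ M, P (some (insert x (A.erase (σ x)))) (neighbours A.toLeft).card := by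
  set X := candidates t Z (j + 1) A with hX
  set M := ρ.basis (j + 1) A X (gain f A) with hMdef
  have hM : c.IsMaxBasis X (gain f A) M := ρ.basis_spec _ _ _ _
    (exists_isMaxBasis hA.feasible.1 (Y := A ∪ Z)
      ((Finset.card_union_le _ _).trans (by rw [hA.card, hZc]; omega))
      (fun x hx => mem_candidates.2 (by
        simp only [Finset.mem_union, not_or] at hx
        exact ⟨hx.1, fun _ => hx.2⟩)) _)
  have hMA : Disjoint M A := disjoint_of_subset_candidates hM.2.1
  set σ := ρ.removal (j + 1) M A (gain f A) with hσdef
  have hσ : c.IsRemoval M A σ := ρ.removal_spec _ _ _ _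
    (exists_isRemoval hA.feasible hA.card hM.1 hMA (hA.card_toLeft.trans_lt hj))
  have hMc := (isBasis_iff.1 hM.1).2
  have hcond : c.IsMaxBasis X (gain f A) M ∧ c.IsRemoval M A σ ∧ M.Nonempty :=
    ⟨hM, hσ, Finset.card_pos.1 (by omega)⟩
  refine ⟨M, σ, hM, hσ, fun h => ?_, fun P => ?_⟩
  · rw [guidedStep, expect_marginals_bind]
    refine Eq.trans (congrArg (fun y => OracleAlg.expect f y h) (dif_pos hcond)) ?_
    exact congrArg (fun y : ℕ => (y : ℝ)⁻¹ * ∑ x ∈ M, h (some (insert x (A.erase (σ x))))) hMc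
  · rw [guidedStep, always_marginals_bind]
    refine Iff.trans (iff_of_eq (congrArg (fun y => OracleAlg.Always f y _) (dif_pos hcond))) ?_
    simp only [OracleAlg.Always, zero_add]
    rfl

theorem guidedRG_always [Nonempty α] (ρ : Rules c) (f : Finset α → ℝ) {t : ℝ} {Z : Finset c.Ext}
    (hZ : c.ExtFeasible Z) (hZc : Z.card = c.budget) {j : ℕ} (hj : j ≤ c.budget) :
    (guidedRG ρ t Z j).Always f fun o n => ∃ A, o = some A ∧ IsIterate t Z j A ∧
      n ≤ j * (3 * Fintype.card α) := by
  induction j with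
  | zero => exact ⟨c.dummies, rfl, isIterate_dummies hZ.1 t Z, by simp⟩
  | succ j ih =>
    rw [guidedRG, OracleAlg.always_bind]
    refine (ih (by omega)).mono ?_
    rintro _ n ⟨A, rfl, hA, hn⟩
    obtain ⟨M, σ, hM, hσ, -, h⟩ := guidedStep_spec ρ f hZc hj hA
    refine (h _).2 fun x hx => ⟨_, rfl, hA.succ hM.2.1 hσ hx, ?_⟩
    have := card_neighbours_le A.toLeft
    rw [Nat.add_mul]
    omega

/-- Expectation of `h` at the solution after `j` iterations. -/
noncomputable def meanAfter (ρ : Rules c) (f : Finset α → ℝ) (t : ℝ) (Z : Finset c.Ext) (j : ℕ)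
    (h : Finset c.Ext → ℝ) : ℝ :=
  (guidedRG ρ t Z j).expect f fun o => o.elim 0 h

theorem meanAfter_zero (ρ : Rules c) (f : Finset α → ℝ) (t : ℝ) (Z : Finset c.Ext)
    (h : Finset c.Ext → ℝ) : meanAfter ρ f t Z 0 h = h c.dummies := rfl

/-- Averages an inequality that holds for every reachable solution; its linearity in `h` and `h'` is
what lets the expectation pass through. -/
theorem le_meanAfter_succ [Nonempty α] (ρ : Rules c) (f : Finset α → ℝ) {t : ℝ} {Z : Finset c.Ext}
    (hZ : c.ExtFeasible Z) (hZc : Z.card = c.budget) {j : ℕ} (hj : j < c.budget)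
    {h h' : Finset c.Ext → ℝ} {a b d : ℝ}
    (H : ∀ A, IsIterate t Z j A → ∀ M σ, c.IsMaxBasis (candidates t Z (j + 1) A) (gain f A) M →
      c.IsRemoval M A σ →
      c.budget * (a * h A + b * h' A + d) ≤ ∑ x ∈ M, h (insert x (A.erase (σ x)))) :
    a * meanAfter ρ f t Z j h + b * meanAfter ρ f t Z j h' + d ≤
      meanAfter ρ f t Z (j + 1) h := by
  have hk : (0 : ℝ) < c.budget := by exact_mod_cast hj.pos
  simp only [meanAfter]
  rw [guidedRG, OracleAlg.expect_bind, ← OracleAlg.expect_const_mul, ← OracleAlg.expect_const_mul,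
    ← OracleAlg.expect_const f (guidedRG ρ t Z j) d, ← OracleAlg.expect_add,
    ← OracleAlg.expect_add]
  refine OracleAlg.expect_mono ((guidedRG_always ρ f hZ hZc hj.le).mono ?_)
  rintro _ n ⟨A, rfl, hA, -⟩
  obtain ⟨M, σ, hM, hσ, he, -⟩ := guidedStep_spec ρ f hZc hj hA
  have := H A hA M σ hM hσ
  simp only [Option.elim_some, he]
  rw [le_inv_mul_iff₀ hk]
  exact this

end Constraint

/-! ### Exponential estimates, linear recursions and the numerical constants. -/

section Numerics

theorem exp_neg_le_one_sub_pow {x : ℝ} (hx : x < 1) (n : ℕ) :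
    Real.exp (-(n * (x / (1 - x)))) ≤ (1 - x) ^ n := by
  have h1 : 0 < 1 - x := by linarith
  have h2 : Real.exp (-(x / (1 - x))) ≤ 1 - x := by
    rw [Real.exp_neg, inv_le_comm₀ (Real.exp_pos _) h1]
    refine le_trans (le_of_eq ?_) (Real.add_one_le_exp _)
    field_simp
    ring
  calc Real.exp (-(n * (x / (1 - x)))) = Real.exp (-(x / (1 - x))) ^ n := by
        rw [← Real.exp_nat_mul]; ring_nf
    _ ≤ _ := pow_le_pow_left₀ (Real.exp_pos _).le h2 n

theorem exp_mul_le_one_sub_pow {x w : ℝ} (hx : x < 1) {n : ℕ} (hn : n * x ≤ w) :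
    Real.exp (-w) * (1 - w * (x / (1 - x))) ≤ (1 - x) ^ n := by
  have h1 : 0 < 1 - x := by linarith
  refine le_trans ?_ (exp_neg_le_one_sub_pow hx n)
  have h2 : -(w * (x / (1 - x))) + -w ≤ -(n * (x / (1 - x))) := by
    have : w * (x / (1 - x)) + w = w / (1 - x) := by field_simp; ring
    have h3 : n * (x / (1 - x)) ≤ w / (1 - x) := by
      rw [← mul_div_assoc]
      gcongr
    linarith
  calc _ ≤ Real.exp (-w) * Real.exp (-(w * (x / (1 - x)))) := by
        gcongr
        linarith [Real.add_one_le_exp (-(w * (x / (1 - x))))]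
    _ = Real.exp (-(w * (x / (1 - x))) + -w) := by rw [Real.exp_add, mul_comm]
    _ ≤ _ := Real.exp_le_exp.2 h2

/-- The exponents here and in the next lemma are l(1 − t), namely 1 − 0.372 and 2(1 − 0.559): the
limit of rⁿ over the second phase is exp(−l(1 − t)). -/
theorem exp_neg_0628_ge : (0.5336 : ℝ) ≤ Real.exp (-0.628) := by
  have h := Real.exp_bound (x := -0.628) (by norm_num [abs_le]) (n := 8) (by norm_num)
  rw [abs_le] at h
  norm_num [Finset.sum_range_succ, Nat.factorial] at h
  norm_num
  linarith [h.1]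

theorem exp_neg_0882_ge : (0.4139 : ℝ) ≤ Real.exp (-0.882) := by
  have h := Real.exp_bound (x := -0.882) (by norm_num [abs_le]) (n := 9) (by norm_num)
  rw [abs_le] at h
  norm_num [Finset.sum_range_succ, Nat.factorial] at h
  norm_num
  linarith [h.1]

theorem exp_neg_two_le : Real.exp (-2) ≤ 0.1354 := by
  have h := Real.exp_neg_one_lt_d9
  have : Real.exp (-2) = Real.exp (-1) * Real.exp (-1) := by rw [← Real.exp_add]; norm_num
  rw [this]
  nlinarith [Real.exp_pos (-1)]

/-- In essence 1 − rˢ = (1 − r)(1 + r + ⋯ + rˢ⁻¹) ≥ (1 − r) s rˢ⁻¹. It yields the nonnegativity of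
the coefficient cY. -/
theorem mul_pow_le_mul_one_sub_pow {r : ℝ} (h0 : 0 ≤ r) (h1 : r ≤ 1) (s : ℕ) :
    (1 - r) * s * r ^ s ≤ r * (1 - r ^ s) := by
  induction s with
  | zero => simp
  | succ s ih =>
    have h2 : r ^ s ≤ 1 := pow_le_one₀ h0 h1
    have h3 : 0 ≤ r * (1 - r) * (1 - r ^ s) :=
      mul_nonneg (mul_nonneg h0 (by linarith)) (by linarith)
    push_cast
    rw [pow_succ]
    nlinarith

/-- The bound for a linear combination of `W` and `Y` under the local search guarantees. -/
theorem le_of_local_optimum {u v F W Y K cW cW' cY ε ρ : ℝ} (hu : K * F - cW * W - cY * Y ≤ u)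
    (hcW : cW ≤ cW') (hcY : 0 ≤ cY) (hcYW : cY ≤ cW') (hW0 : 0 ≤ W) (hF : 0 ≤ F) (hε : 0 ≤ ε)
    (hW : W ≤ (1 + ε) * v) (hWY : W + Y ≤ (2 + ε) * v) (hv : v ≤ ρ * F)
    (h : ρ * (1 + cY + (1 + ε) * cW') ≤ K) : ρ * F ≤ u := by
  have h1 : cW * W ≤ cW' * W := by gcongr
  have h2 : (cW' - cY) * W ≤ (cW' - cY) * ((1 + ε) * v) :=
    mul_le_mul_of_nonneg_left hW (by linarith)
  have h3 := mul_le_mul_of_nonneg_left hWY hcY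
  have h4 : (cY + (1 + ε) * cW') * v ≤ (cY + (1 + ε) * cW') * (ρ * F) := by
    refine mul_le_mul_of_nonneg_left hv ?_
    have : 0 ≤ cW' := hcY.trans hcYW
    positivity
  have h5 := mul_le_mul_of_nonneg_right h hF
  nlinarith

/-- To be read with p = rⁿ, P = rⁿ⁻¹, q = rᵏ, Q = rᵏ⁻¹ and L = n/k; in the limit q and Q are both
1/e. -/
theorem size_polynomial_bound {p P q Q L ε : ℝ} (hε0 : 0 ≤ ε) (hε : ε ≤ 0.385)
    (hp : 0.5336 * (1 - 1.628 * ε) ≤ p) (hP : 0.5336 * (1 - 1.03 * ε) ≤ P) (hL : 0.628 ≤ L)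
    (hq : q ≤ 0.3679) (hQ : 0.36787 ≤ Q) :
    0.385 - ε ≤ (p - q) * (1 - 2 * (0.385 - ε) - ε * (0.385 - ε)) +
      (1 - (0.385 - ε)) * (L * P) + (0.385 - ε) * Q := by
  have h1 : (0.5336 * (1 - 1.628 * ε) - 0.3679) * (1 - 2 * (0.385 - ε) - ε * (0.385 - ε)) ≤
      (p - q) * (1 - 2 * (0.385 - ε) - ε * (0.385 - ε)) :=
    mul_le_mul_of_nonneg_right (by linarith) (by nlinarith)
  have h2 : 0.628 * (0.5336 * (1 - 1.03 * ε)) ≤ L * P :=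
    mul_le_mul hL hP (by nlinarith) (by linarith)
  have h3 : (1 - (0.385 - ε)) * (0.628 * (0.5336 * (1 - 1.03 * ε))) ≤
      (1 - (0.385 - ε)) * (L * P) := mul_le_mul_of_nonneg_left h2 (by linarith)
  have h4 : (0.385 - ε) * 0.36787 ≤ (0.385 - ε) * Q :=
    mul_le_mul_of_nonneg_left hQ (by linarith)
  have h5 : 0 ≤ ε * (0.385 - ε) := mul_nonneg hε0 (by linarith)
  have h6 : 0 ≤ ε * (ε * (0.385 - ε)) := mul_nonneg hε0 h5
  nlinarith

/-- The letters mean the same as for the size constraint, with r = 1 − 2/k, and T = (s/k)(1/k) is a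
correction of lower order. -/
theorem matroid_polynomial_bound {p P q Q L T ε : ℝ} (hε0 : 0 ≤ ε) (hε : ε ≤ 0.305)
    (hp0 : 0 ≤ p) (hP0 : 0 ≤ P)
    (hp : 0.4139 * (1 - 3.764 * ε) ≤ p) (hP : 0.4139 * (1 - 3.528 * ε) ≤ P) (hL : 0.441 ≤ L)
    (hT : T ≤ 0.559 * ε) (hq : q ≤ 0.1354) (hqQ : q ≤ Q) :
    0.305 - ε ≤ 1 / 4 + p * (1 / 4 - (0.305 - ε) * (3 / 4 + ε / 2)) +
      P * (L * (1 - (0.305 - ε)) / 2 - (0.305 - ε) * (1 + ε) * T) +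
      q * (-1 / 2 + (0.305 - ε) * (3 / 4 + ε / 2)) + (0.305 - ε) * Q / 2 := by
  have hρ : 0 ≤ 0.305 - ε := by linarith
  have e1 : 0 ≤ ε * (0.305 - ε) := mul_nonneg hε0 hρ
  have hcp : 0.02125 ≤ 1 / 4 - (0.305 - ε) * (3 / 4 + ε / 2) := by nlinarith
  have h1 : (0.305 - ε) * q ≤ (0.305 - ε) * Q := mul_le_mul_of_nonneg_left hqQ hρ
  have h2 : 0 ≤ (0.1354 - q) * (1 / 2 - (0.305 - ε) * (5 / 4 + ε / 2)) :=
    mul_nonneg (by linarith) (by nlinarith)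
  have h3 : (0.305 - ε) * (1 + ε) * T ≤ (0.305 - ε) * (1 + ε) * (0.559 * ε) := by gcongr
  have h4 : 0.441 * (1 - (0.305 - ε)) ≤ L * (1 - (0.305 - ε)) :=
    mul_le_mul_of_nonneg_right hL (by linarith)
  have e3 : (0.305 - ε) * (1 + ε) * (0.559 * ε) ≤ 0.2 * ε := by nlinarith
  have h5 : 0.153 ≤ L * (1 - (0.305 - ε)) / 2 - (0.305 - ε) * (1 + ε) * T := by linarith
  -- For large ε the target is so small that the terms in `p` and `P` can be dropped as nonnegative.
  rcases le_total ε 0.15 with h | h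
  · have h6 := mul_le_mul hp hcp (by norm_num) hp0
    have h7 := mul_le_mul hP h5 (by norm_num) hP0
    nlinarith
  · have h6 := mul_nonneg hp0 ((by norm_num : (0 : ℝ) ≤ 0.02125).trans hcp)
    have h7 := mul_nonneg hP0 ((by norm_num : (0 : ℝ) ≤ 0.153).trans h5)
    nlinarith

theorem affine_recursion_le {x : ℕ → ℝ} {r m x₀ : ℝ} (hr : 0 ≤ r) (h0 : x₀ ≤ x 0) {s : ℕ}
    (h : ∀ j < s, r * x j + (1 - r) * m ≤ x (j + 1)) :
    ∀ j ≤ s, m + r ^ j * (x₀ - m) ≤ x j := by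
  intro j
  induction j with
  | zero => intro _; simpa using h0
  | succ j ih =>
    intro hj
    have h1 := mul_le_mul_of_nonneg_left (ih (by omega)) hr
    have h2 := h j (by omega)
    calc _ = r * (m + r ^ j * (x₀ - m)) + (1 - r) * m := by ring
      _ ≤ _ := by linarith

/-- The forcing rʲ d is in resonance with the homogeneous solution, hence the term j rʲ⁻¹ d/k.
Writing rʲ⁻¹ as rʲ/r avoids truncated subtraction at j = 0. -/
theorem forced_recursion_le {x : ℕ → ℝ} {r l k m d x₀ : ℝ} (hr : 0 < r) (hl : l ≠ 0) (hk : k ≠ 0)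
    (hrk : r = 1 - l / k) (h0 : x₀ ≤ x 0) {s : ℕ}
    (h : ∀ j < s, r * x j + (m + r ^ j * d) / k ≤ x (j + 1)) :
    ∀ j ≤ s, r ^ j * x₀ + m * (1 - r ^ j) / l + j / k * (r ^ j / r) * d ≤ x j := by
  intro j
  induction j with
  | zero => intro _; simpa using h0
  | succ j ih =>
    intro hj
    have h1 := mul_le_mul_of_nonneg_left (ih (by omega)) hr.le
    have h2 := h j (by omega)
    refine le_trans (le_of_eq ?_) ((add_le_add_left h1 _).trans h2)
    have hr' : r ≠ 0 := hr.ne'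
    have e : m / k = m * (1 - r) / l := by rw [hrk]; field_simp; ring
    rw [add_div, e]
    push_cast
    field_simp
    ring

/-- Two-phase recursion of the guided random greedy algorithm; `l - 1` is the loss factor. -/
theorem two_phase_recursion_le {u a b : ℕ → ℝ} {k s n : ℕ} {l r F X Y : ℝ} (hk : 0 < k)
    (hsn : s + n = k) (hl : 0 < l) (hr : 0 < r) (hrk : r = 1 - l / k)
    (hu0 : 0 ≤ u 0) (ha0 : F ≤ a 0) (hb0 : X ≤ b 0)
    (hb : ∀ j < s, r * b j + (l * X - Y) / k ≤ b (j + 1))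
    (ha : ∀ j < s, r * a j + (l * F - Y) / k ≤ a (j + 1))
    (hu : ∀ j < s, r * u j + b j / k ≤ u (j + 1))
    (ha' : ∀ j < k, r * a j + (l - 1) * F / k ≤ a (j + 1))
    (hu' : ∀ j < k, s ≤ j → r * u j + a j / k ≤ u (j + 1)) :
    r ^ n * ((X - Y / l) * (1 - r ^ s) / l + s / k * (r ^ s / r) * (Y / l)) +
      (l - 1) * F / l * (1 - r ^ n) / l +
      n / k * (r ^ n / r) * (F - Y / l + r ^ s * (Y / l) - (l - 1) * F / l) ≤ u k := by
  have hk0 : (0 : ℝ) < k := by exact_mod_cast hk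
  have hk' : (k : ℝ) ≠ 0 := hk0.ne'
  have hl' : l ≠ 0 := hl.ne'
  -- A constant forcing V/k has the fixed point V/l.
  have fix : ∀ V, (1 - r) * (V / l) = V / k := fun V => by rw [hrk]; field_simp; ring
  have hbs := affine_recursion_le (x := b) (m := (l * X - Y) / l) hr.le hb0
    fun j hj => (fix _).symm ▸ hb j hj
  have has := affine_recursion_le (x := a) (m := (l * F - Y) / l) hr.le ha0
    (fun j hj => (fix _).symm ▸ ha j hj) s le_rfl
  have hus := forced_recursion_le (x := u) (m := X - Y / l) (d := Y / l) hr hl' hk' hrk hu0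
    (fun j hj => by
      refine le_trans ?_ (hu j hj)
      have := hbs j hj.le
      have e : (l * X - Y) / l = X - Y / l := by field_simp
      rw [e] at this
      gcongr
      linarith) s le_rfl
  have hat := affine_recursion_le (x := fun j => a (s + j)) (m := (l - 1) * F / l) (s := n)
    hr.le has fun j hj => (fix _).symm ▸ ha' (s + j) (by omega)
  have hut := forced_recursion_le (x := fun j => u (s + j)) (m := (l - 1) * F / l) (s := n)
    (d := (l * F - Y) / l + r ^ s * (F - (l * F - Y) / l) - (l - 1) * F / l)
    hr hl' hk' hrk hus (fun j hj => by
      refine le_trans ?_ (hu' (s + j) (by omega) (by omega))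
      have := hat j hj.le
      gcongr) n le_rfl
  rw [hsn] at hut
  refine le_trans (le_of_eq ?_) hut
  field_simp
  ring

theorem cast_sub_one_lt_of_add_eq {k s n : ℕ} {t : ℝ} (hs' : t * k < s + 1)
    (hsn : s + n = k) : (n : ℝ) - 1 < (1 - t) * k := by
  have : (s : ℝ) + n = k := by exact_mod_cast hsn
  linarith

theorem size_two_phase_bound {k s n : ℕ} {ε : ℝ} (hsn : s + n = k) (hn : 0 < n)
    (hs : (s : ℝ) ≤ 0.372 * k) (hs' : 0.372 * k < (s : ℝ) + 1) (hk : (k : ℝ)⁻¹ ≤ ε)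
    (hε : ε ≤ 0.385) {r : ℝ} (hr : r = 1 - 1 / k) :
    let g := r ^ s
    let p := r ^ n
    0 ≤ p * (1 - g) - s / k * (p * g / r) + n / k * (p / r) * (1 - g) ∧
    p * (1 - g) - s / k * (p * g / r) + n / k * (p / r) * (1 - g) ≤ p * (1 - g) ∧
    (0.385 - ε) * (1 + (p * (1 - g) - s / k * (p * g / r) + n / k * (p / r) * (1 - g)) +
      (1 + ε) * (p * (1 - g))) ≤ p * (1 - g) + n / k * (p / r) := by
  intro g p
  have hk0 : (0 : ℝ) < k := by exact_mod_cast (by omega : 0 < k)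
  set y := (k : ℝ)⁻¹ with hy
  have hy0 : 0 < y := inv_pos.2 hk0
  have hky : (k : ℝ) * y = 1 := mul_inv_cancel₀ hk0.ne'
  have hr' : r = 1 - y := by rw [hr, one_div]
  have hr0 : 0 < r := by linarith
  have hr1 : r ≤ 1 := by linarith
  have hsnR : (s : ℝ) / k + n / k = 1 := by
    rw [← add_div, ← Nat.cast_add, hsn, div_self hk0.ne']
  have hg0 : 0 < g := pow_pos hr0 s
  have hg1 : g ≤ 1 := pow_le_one₀ hr0.le hr1
  have hp0 : 0 < p := pow_pos hr0 n
  have hP0 : 0 < p / r := by positivity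
  have hL0 : 0 ≤ (n : ℝ) / k := by positivity
  -- Bernoulli: 1 − s/k ≤ (1 − 1/k)ˢ. This is exactly what makes cY ≤ cW.
  have hbern : (n : ℝ) / k ≤ g := by
    have := one_add_mul_le_pow (a := -y) (by linarith) s
    have e : (s : ℝ) / k = s * y := by rw [hy]; rfl
    have e2 : 1 + -y = r := by rw [hr']; ring
    rw [e2] at this
    change _ ≤ g at this
    linarith
  have hfirst : s / k * (p * g / r) ≤ p * (1 - g) := by
    have := mul_pow_le_mul_one_sub_pow hr0.le hr1 s
    have e : s / k * (p * g / r) = p * ((1 - r) * s * g / r) := by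
      rw [hr', div_eq_mul_inv (s : ℝ) (k : ℝ), ← hy]; ring
    rw [e]
    gcongr
    rw [div_le_iff₀ hr0]
    linarith
  refine ⟨?_, ?_, ?_⟩
  · have : 0 ≤ n / k * (p / r) * (1 - g) := mul_nonneg (by positivity) (by linarith)
    linarith
  · have : n / k * (p / r) * (1 - g) ≤ s / k * (p * g / r) := by
      have e1 : n / k * (p / r) * (1 - g) = p / r * (n / k * (1 - g)) := by ring
      have e2 : s / k * (p * g / r) = p / r * (s / k * g) := by ring
      rw [e1, e2]
      gcongr ?_ * ?_
      have e3 : (s : ℝ) / k = 1 - n / k := by linarith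
      rw [e3]
      linarith
    linarith
  · obtain ⟨m, rfl⟩ : ∃ m, n = m + 1 := ⟨n - 1, by omega⟩
    have hPm : p / r = r ^ m := by
      rw [div_eq_iff hr0.ne']; exact pow_succ r m
    have hm : m * y ≤ 0.628 := by
      have := cast_sub_one_lt_of_add_eq hs' hsn
      push_cast at this
      nlinarith
    -- Since y ≤ ε ≤ 0.385, 1/(1 − y) ≤ 1/0.615 < 1.64; then 0.628 · 1.64 < 1.03.
    have hxy : y / (1 - y) ≤ 1.64 * y := by
      rw [div_le_iff₀ (by linarith)]
      nlinarith
    have hPl := exp_mul_le_one_sub_pow (by linarith) hm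
    rw [← hr', ← hPm] at hPl
    have hE := exp_neg_0628_ge
    have hP1 : 0.5336 * (1 - 0.628 * (y / r)) ≤ p / r := by
      refine le_trans ?_ hPl
      rw [hr']
      gcongr
      linarith
    rw [← hr'] at hxy
    have hP2 : 0.5336 * (1 - 1.03 * ε) ≤ p / r := by linarith
    have hp2 : 0.5336 * (1 - 1.628 * ε) ≤ p := by
      have h1 := mul_le_mul_of_nonneg_right hP1 hr0.le
      have h2 : 0.5336 * (1 - 0.628 * (y / r)) * r = 0.5336 * (1 - 1.628 * y) := by
        field_simp; rw [hr']; ring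
      rw [h2, div_mul_cancel₀ _ hr0.ne'] at h1
      linarith
    have hpg : p * g = r ^ k := by
      rw [← hsn, add_comm, pow_add]
    have hQ : Real.exp (-1) ≤ p * g / r := by
      obtain ⟨i, rfl⟩ : ∃ i, k = i + 1 := ⟨k - 1, by omega⟩
      rw [hpg, pow_succ, mul_div_cancel_right₀ _ hr0.ne', hr']
      refine le_trans (le_of_eq ?_) (exp_neg_le_one_sub_pow (by linarith) i)
      congr 1
      rw [← hr']
      have : (i : ℝ) * y = r := by push_cast at hky; linarith
      rw [← mul_div_assoc, this, div_self hr0.ne']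
    have hq : p * g ≤ Real.exp (-1) := by
      rw [hpg, hr']
      have := Real.one_sub_div_pow_le_exp_neg (n := k) (t := 1) (by nlinarith)
      rwa [one_div] at this
    have hL : 0.628 ≤ ((m + 1 : ℕ) : ℝ) / k := by
      have : (s : ℝ) / k ≤ 0.372 := by rw [div_le_iff₀ hk0]; exact hs
      linarith
    have := size_polynomial_bound (by linarith) hε hp2 hP2 hL
      (hq.trans (by linarith [Real.exp_neg_one_lt_d9]))
      (le_trans (by linarith [Real.exp_neg_one_gt_d9]) hQ)
    have hs1 : (s : ℝ) / k = 1 - ((m + 1 : ℕ) : ℝ) / k := by linarith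
    rw [hs1]
    have e3 : p * g / r = p / r * g := by ring
    rw [e3] at this ⊢
    refine le_of_sub_nonneg (le_trans (sub_nonneg.2 this) (le_of_eq ?_))
    ring

theorem pow_bounds_of_le {y ε : ℝ} (hy0 : 0 ≤ y) (hy4 : y ≤ 1 / 4) (hy : y ≤ ε) {m : ℕ}
    (hm : m * (2 * y) ≤ 0.882) :
    0.4139 * (1 - 3.528 * ε) ≤ (1 - 2 * y) ^ m ∧
      0.4139 * (1 - 3.764 * ε) ≤ (1 - 2 * y) ^ (m + 1) := by
  have hr0 : 0 < 1 - 2 * y := by linarith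
  have hPl := exp_mul_le_one_sub_pow (by linarith) hm
  have hpow : 0 ≤ (1 - 2 * y) ^ m := by positivity
  have hE := exp_neg_0882_ge
  have hxy : 2 * y / (1 - 2 * y) ≤ 4 * y := by
    rw [div_le_iff₀ hr0]
    nlinarith
  have h2 : (1 - 0.882 * (2 * y / (1 - 2 * y))) * (1 - 2 * y) = 1 - 3.764 * y := by
    field_simp
    ring
  rcases le_total (1 - 0.882 * (2 * y / (1 - 2 * y))) 0 with h | h
  · have := mul_nonneg_of_nonpos_of_nonpos h (by linarith : -(1 - 2 * y) ≤ 0)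
    exact ⟨by linarith, le_trans (by linarith) (pow_nonneg hr0.le _)⟩
  · have h3 := (mul_le_mul_of_nonneg_right hE h).trans hPl
    have h1 := mul_le_mul_of_nonneg_right h3 hr0.le
    rw [mul_assoc, h2, ← pow_succ] at h1
    exact ⟨by linarith, by linarith⟩

/-- The true coefficient of f(Z ∩ O) is p(1 − g)/2. The second summand of `cW` is added so that cW −
cY becomes p/r times (1/4 + 1/(2k)) (g − 1 + 2s/k), which is nonnegative by Bernoulli. -/
theorem matroid_two_phase_bound {k s n : ℕ} {ε : ℝ} (hsn : s + n = k) (hn : 0 < n)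
    (hs : (s : ℝ) ≤ 0.559 * k) (hs' : 0.559 * k < (s : ℝ) + 1) (hk : (k : ℝ)⁻¹ ≤ ε)
    (hε : ε ≤ 0.305) {r : ℝ} (hr : r = 1 - 2 / k) :
    let g := r ^ s
    let p := r ^ n
    let cW := p * (1 - g) / 2 + p / r * (s / k * (k : ℝ)⁻¹)
    let cY := (p * (1 - g) / 2 - s / k * (p * g / r)) / 2 + n / k * (p / r) * (1 - g) / 2
    p * (1 - g) / 2 ≤ cW ∧ 0 ≤ cY ∧ cY ≤ cW ∧
    (0.305 - ε) * (1 + cY + (1 + ε) * cW) ≤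
      p * (1 - g) / 2 + (1 - p) / 4 + n / k * (p / r) / 2 := by
  intro g p cW cY
  have hk0 : (0 : ℝ) < k := by exact_mod_cast (by omega : 0 < k)
  have hcW : cW = p * (1 - g) / 2 + p / r * (s / k * (k : ℝ)⁻¹) := rfl
  have hcY : cY = (p * (1 - g) / 2 - s / k * (p * g / r)) / 2 + n / k * (p / r) * (1 - g) / 2 :=
    rfl
  clear_value cW cY
  set y := (k : ℝ)⁻¹ with hy
  have hy0 : 0 < y := inv_pos.2 hk0
  have hky : (k : ℝ) * y = 1 := mul_inv_cancel₀ hk0.ne'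
  have hk4 : (4 : ℝ) ≤ k := by
    have : 3 < k := by
      by_contra! h
      have : (k : ℝ) ≤ 3 := by exact_mod_cast h
      nlinarith
    exact_mod_cast this
  have hy4 : y ≤ 1 / 4 := by nlinarith
  have hr' : r = 1 - 2 * y := by rw [hr, div_eq_mul_inv]
  have hr0 : 0 < r := by linarith
  have hr1 : r ≤ 1 := by linarith
  have hsnR : (s : ℝ) / k + n / k = 1 := by
    rw [← add_div, ← Nat.cast_add, hsn, div_self hk0.ne']
  have esy : (s : ℝ) / k = s * y := by rw [hy]; rfl
  have hg0 : 0 < g := pow_pos hr0 s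
  have hg1 : g ≤ 1 := pow_le_one₀ hr0.le hr1
  have hp0 : 0 < p := pow_pos hr0 n
  have hP0 : 0 < p / r := by positivity
  have hL0 : 0 ≤ (n : ℝ) / k := by positivity
  have hs0 : 0 ≤ (s : ℝ) / k := by positivity
  have hbern : 1 - 2 * (s / k) ≤ g := by
    have := one_add_mul_le_pow (a := -(2 * y)) (by linarith) s
    have e2 : 1 + -(2 * y) = r := by rw [hr']; ring
    rw [e2] at this
    change _ ≤ g at this
    linarith
  have hfirst : s / k * (p * g / r) ≤ p * (1 - g) / 2 := by
    have := mul_pow_le_mul_one_sub_pow hr0.le hr1 s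
    have e : s / k * (p * g / r) = p * ((1 - r) * s * g / r) / 2 := by
      rw [hr', esy]; ring
    rw [e]
    gcongr
    rw [div_le_iff₀ hr0]
    linarith
  refine ⟨?_, ?_, ?_, ?_⟩
  · have : 0 ≤ p / r * (s / k * y) := by positivity
    linarith
  · have : 0 ≤ n / k * (p / r) * (1 - g) := mul_nonneg (by positivity) (by linarith)
    linarith
  · have e : cW - cY = p / r * (r * (1 - g) / 4 + s / k * y - n / k * (1 - g) / 2
        + s / k * g / 2) := by
      rw [hcW, hcY]
      field_simp
      ring
    have h2 : 0 ≤ p / r * (r * (1 - g) / 4 + s / k * y - n / k * (1 - g) / 2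
        + s / k * g / 2) := by
      refine mul_nonneg hP0.le ?_
      have e3 : (n : ℝ) / k = 1 - s / k := by linarith
      rw [e3, hr']
      have := mul_le_mul_of_nonneg_right hbern (by linarith : 0 ≤ 1 / 4 + y / 2)
      nlinarith
    linarith
  · obtain ⟨m, rfl⟩ : ∃ m, n = m + 1 := ⟨n - 1, by omega⟩
    have hPm : p / r = r ^ m := by
      rw [div_eq_iff hr0.ne']; exact pow_succ r m
    have hm : m * (2 * y) ≤ 0.882 := by
      have := cast_sub_one_lt_of_add_eq hs' hsn
      push_cast at this
      nlinarith
    obtain ⟨hP2, hp2⟩ := pow_bounds_of_le hy0.le hy4 hk hm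
    rw [← hr', ← hPm] at hP2
    rw [← hr'] at hp2
    have hpg : p * g = r ^ k := by
      rw [← hsn, add_comm, pow_add]
    have hq : p * g ≤ Real.exp (-2) := by
      rw [hpg, hr]
      exact Real.one_sub_div_pow_le_exp_neg (n := k) (t := 2) (by linarith)
    have hQ : p * g ≤ p * g / r := by
      rw [le_div_iff₀ hr0]
      exact mul_le_of_le_one_right (by positivity) hr1
    have hs1 : (s : ℝ) / k ≤ 0.559 := by rw [div_le_iff₀ hk0]; exact hs
    have hL : 0.441 ≤ ((m + 1 : ℕ) : ℝ) / k := by linarith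
    have hT : s / k * y ≤ 0.559 * ε := mul_le_mul hs1 hk hy0.le (by norm_num)
    have := matroid_polynomial_bound (by linarith) hε hp0.le hP0.le hp2 hP2 hL hT
      (hq.trans exp_neg_two_le) hQ
    have hs2 : (s : ℝ) / k = 1 - ((m + 1 : ℕ) : ℝ) / k := by linarith
    rw [hcW, hcY]
    have e3 : p * g / r = p / r * g := by ring
    rw [e3] at this ⊢
    refine le_of_sub_nonneg (le_trans (sub_nonneg.2 this) (le_of_eq ?_))
    rw [hs2]
    ring

end Numerics

/-! ### Expected progress of guided random greedy. -/

namespace Constraint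

variable {α : Type u} {c : Constraint α} [DecidableEq α] [Fintype α]

/-- T \ A, padded with unused dummies, competes with `M`, and its marginal gains sum to at least f(T
∪ A) − f(A). -/
theorem sub_le_sum_of_isMaxBasis {f : Finset α → ℝ} (hf : IsSubmodular f) {t : ℝ}
    {Z : Finset c.Ext} (hZc : Z.card = c.budget) {j : ℕ} {A M : Finset c.Ext}
    (hA : IsIterate t Z j A) (hM : c.IsMaxBasis (candidates t Z (j + 1) A) (gain f A) M)
    {T : Finset α} (hT : c.Feasible T)
    (hTZ : ((j + 1 : ℕ) : ℝ) ≤ t * c.budget → Disjoint T Z.toLeft) :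
    f (T ∪ A.toLeft) - f A.toLeft ≤ ∑ x ∈ M, (f (insert x A).toLeft - f A.toLeft) := by
  obtain ⟨B, hB, hBc, hBl, hBX⟩ := exists_basis_toLeft_eq (c := c)
    (hT.mono (Finset.sdiff_subset (s := T) (t := A.toLeft))) (A ∪ Z)
    ((Finset.card_union_le _ _).trans (by rw [hA.card, hZc]; omega))
  have hsub : B ⊆ candidates t Z (j + 1) A := by
    intro x hx
    rw [mem_candidates]
    rcases x with x | d
    · have hx' : x ∈ T \ A.toLeft := by rw [← hBl]; simpa using hx
      rw [Finset.mem_sdiff, Finset.mem_toLeft] at hx'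
      refine ⟨hx'.2, fun h hxZ => ?_⟩
      exact Finset.disjoint_left.1 (hTZ h) hx'.1 (by simpa using hxZ)
    · have := hBX d hx
      simp only [Finset.mem_union, not_or] at this
      exact ⟨this.1, fun _ => this.2⟩
  have h1 := hM.2.2 B (isBasis_iff.2 ⟨hB, hBc⟩) hsub
  rw [Finset.sum_congr rfl fun x hx => gain_of_notMem f (mem_candidates.1 (hsub hx)).1,
    Finset.sum_congr rfl fun x hx => gain_of_notMem f (mem_candidates.1 (hM.2.1 hx)).1] at h1
  have h2 := (isSubmodular_toLeft' (c := c) hf).sub_le_sum_insert A B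
  have e : (A ∪ B).toLeft = T ∪ A.toLeft := by
    rw [Finset.toLeft_union, hBl, Finset.union_sdiff_self_eq_union, Finset.union_comm]
  simp only [e] at h2
  exact h2.trans h1

variable [Nonempty α] (ρ : Rules c) {f : Finset α → ℝ} {t : ℝ} {Z : Finset c.Ext} {j : ℕ}

/-- Expected progress of one iteration towards a feasible set `T`. -/
theorem meanAfter_value_succ (hf : IsSubmodular f) (hf0 : ∀ S, 0 ≤ f S)
    (hZ : c.ExtFeasible Z) (hZc : Z.card = c.budget) (hj : j < c.budget) {T : Finset α}
    (hT : c.Feasible T) (hTZ : ((j + 1 : ℕ) : ℝ) ≤ t * c.budget → Disjoint T Z.toLeft) :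
    (1 - (1 + c.lossFactor) / c.budget) * meanAfter ρ f t Z j (fun A => f A.toLeft) +
        meanAfter ρ f t Z j (fun A => f (T ∪ A.toLeft)) / c.budget ≤
      meanAfter ρ f t Z (j + 1) fun A => f A.toLeft := by
  have hk : (0 : ℝ) < c.budget := by exact_mod_cast hj.pos
  have := le_meanAfter_succ ρ f (t := t) hZ hZc hj (h := fun A => f A.toLeft)
    (h' := fun A => f (T ∪ A.toLeft)) (a := 1 - (1 + c.lossFactor) / c.budget)
    (b := (c.budget : ℝ)⁻¹) (d := 0) fun A hA M σ hM hσ => by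
      have h1 := sub_le_sum_of_isMaxBasis hf hZc hA hM hT hTZ
      have h2 := hσ.le_sum hf (disjoint_of_subset_candidates hM.2.1) ∅
      rw [(isBasis_iff.1 hM.1).2] at h2
      simp only [Finset.empty_union] at h2
      have h3 := mul_nonneg c.lossFactor_nonneg (hf0 ∅)
      have e : (c.budget : ℝ) * ((1 - (1 + c.lossFactor) / c.budget) * f A.toLeft +
          (c.budget : ℝ)⁻¹ * f (T ∪ A.toLeft) + 0) =
          c.budget * f A.toLeft - (1 + c.lossFactor) * f A.toLeft + f (T ∪ A.toLeft) := by
        field_simp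
        ring
      rw [e]
      linarith
  rw [div_eq_inv_mul (meanAfter ρ f t Z j fun A => f (T ∪ A.toLeft))]
  linarith

/-- By submodularity the insertions change f(T ∪ A) by at least f(T ∪ A ∪ M) − f(T ∪ A) in total.
Thus only a lower bound `d` for f(T ∪ A ∪ M) is needed: nonnegativity gives 0, and avoiding Z gives
f(T) − f(T ∪ Z). -/
theorem meanAfter_union_succ (hf : IsSubmodular f)
    (hZ : c.ExtFeasible Z) (hZc : Z.card = c.budget) (hj : j < c.budget) {T : Finset α} {d : ℝ}
    (hd : ∀ A M, IsIterate t Z j A → M ⊆ candidates t Z (j + 1) A →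
      d ≤ f (T ∪ (A ∪ M).toLeft)) :
    (1 - (1 + c.lossFactor) / c.budget) * meanAfter ρ f t Z j (fun A => f (T ∪ A.toLeft)) +
        (c.lossFactor * f T + d) / c.budget ≤
      meanAfter ρ f t Z (j + 1) fun A => f (T ∪ A.toLeft) := by
  have hk : (0 : ℝ) < c.budget := by exact_mod_cast hj.pos
  have := le_meanAfter_succ ρ f (t := t) hZ hZc hj (h := fun A => f (T ∪ A.toLeft))
    (h' := fun A => f (T ∪ A.toLeft)) (a := 1 - (1 + c.lossFactor) / c.budget)
    (b := 0) (d := (c.lossFactor * f T + d) / c.budget) fun A hA M σ hM hσ => by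
      have h1 := hd A M hA hM.2.1
      have h2 := hσ.le_sum hf (disjoint_of_subset_candidates hM.2.1) T
      rw [(isBasis_iff.1 hM.1).2] at h2
      have h3 := (isSubmodular_toLeft (c := c) hf T).sub_le_sum_insert A M
      have e : (c.budget : ℝ) * ((1 - (1 + c.lossFactor) / c.budget) * f (T ∪ A.toLeft) +
          0 * f (T ∪ A.toLeft) + (c.lossFactor * f T + d) / c.budget) =
          c.budget * f (T ∪ A.toLeft) - (1 + c.lossFactor) * f (T ∪ A.toLeft) +
            (c.lossFactor * f T + d) := by
        field_simp
        ring
      rw [e]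
      linarith
  linarith

theorem meanAfter_union_succ_of_le (hf : IsSubmodular f) (hf0 : ∀ S, 0 ≤ f S)
    (hZ : c.ExtFeasible Z) (hZc : Z.card = c.budget) (hj : j < c.budget)
    (hjt : ((j + 1 : ℕ) : ℝ) ≤ t * c.budget) (T : Finset α) :
    (1 - (1 + c.lossFactor) / c.budget) * meanAfter ρ f t Z j (fun A => f (T ∪ A.toLeft)) +
        ((1 + c.lossFactor) * f T - f (T ∪ Z.toLeft)) / c.budget ≤
      meanAfter ρ f t Z (j + 1) fun A => f (T ∪ A.toLeft) := by
  have := meanAfter_union_succ ρ hf (t := t) hZ hZc hj (T := T) (d := f T - f (T ∪ Z.toLeft))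
    fun A M hA hM => hf.le_union_of_disjoint hf0 (by
      rw [Finset.toLeft_union, Finset.disjoint_union_left]
      refine ⟨hA.disjoint (by push_cast at hjt; linarith), Finset.disjoint_left.2 fun x hx hxZ => ?_⟩
      exact (mem_candidates.1 (hM (by simpa using hx))).2 hjt (by simpa using hxZ))
  convert this using 3
  ring

/-- The expected value after the last iteration, for a switch after `s` of the iterations. -/
theorem two_phase_le_meanAfter (hf : IsSubmodular f) (hf0 : ∀ S, 0 ≤ f S) (hZ : c.ExtFeasible Z)
    (hZc : Z.card = c.budget) {O : Finset α} (hO : c.Feasible O) {s n : ℕ}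
    (hsn : s + n = c.budget) (hs : (s : ℝ) ≤ t * c.budget) (hs' : t * c.budget < s + 1)
    {l r : ℝ} (hl : l = 1 + c.lossFactor) (hr : r = 1 - l / c.budget) (hr0 : 0 < r)
    (hk : 0 < c.budget) :
    r ^ n * ((f (O \ Z.toLeft) - f (O ∪ Z.toLeft) / l) * (1 - r ^ s) / l +
        s / c.budget * (r ^ s / r) * (f (O ∪ Z.toLeft) / l)) +
      (l - 1) * f O / l * (1 - r ^ n) / l +
      n / c.budget * (r ^ n / r) * (f O - f (O ∪ Z.toLeft) / l +
        r ^ s * (f (O ∪ Z.toLeft) / l) - (l - 1) * f O / l) ≤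
      meanAfter ρ f t Z c.budget fun A => f A.toLeft := by
  -- The step from j to j + 1 is iteration j + 1, so exactly the steps with j < s avoid Z.
  have hlt : ∀ j, j < s → ((j + 1 : ℕ) : ℝ) ≤ t * c.budget := fun j hj =>
    le_trans (by exact_mod_cast hj) hs
  have hsub := hO.mono (Finset.sdiff_subset (s := O) (t := Z.toLeft))
  refine two_phase_recursion_le (u := fun j => meanAfter ρ f t Z j fun A => f A.toLeft)
    (a := fun j => meanAfter ρ f t Z j fun A => f (O ∪ A.toLeft))
    (b := fun j => meanAfter ρ f t Z j fun A => f (O \ Z.toLeft ∪ A.toLeft)) hk hsn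
    (by linarith [c.lossFactor_nonneg]) hr0 hr (hf0 _) ?_ ?_ ?_ ?_ ?_ ?_ ?_
  · simp [meanAfter_zero, dummies_toLeft]
  · simp [meanAfter_zero, dummies_toLeft]
  · intro j hj
    have := meanAfter_union_succ_of_le ρ hf hf0 hZ hZc (by omega) (hlt j hj) (O \ Z.toLeft)
    rwa [← hl, ← hr, Finset.sdiff_union_self_eq_union] at this
  · intro j hj
    have := meanAfter_union_succ_of_le ρ hf hf0 hZ hZc (by omega) (hlt j hj) O
    rwa [← hl, ← hr] at this
  · intro j hj
    have := meanAfter_value_succ ρ hf hf0 (t := t) hZ hZc (j := j) (by omega) hsub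
      fun _ => Finset.sdiff_disjoint
    rwa [← hl, ← hr] at this
  · intro j hj
    have := meanAfter_union_succ ρ hf hZ hZc hj (t := t) (T := O) (d := 0) fun _ _ _ _ => hf0 _
    rw [← hl, ← hr, add_zero] at this
    rwa [hl, add_sub_cancel_left]
  · intro j hj hsj
    have := meanAfter_value_succ ρ hf hf0 (t := t) hZ hZc hj hO fun h => by
      have : (s : ℝ) ≤ j := by exact_mod_cast hsj
      push_cast at h
      linarith
    rwa [← hl, ← hr] at this

end Constraint

/-! ### Assembly of the guarantee. -/

namespace Constraint

variable {α : Type u} {c : Constraint α}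

theorem pad_toLeft (c : Constraint α) (S : Finset α) : (c.pad S).toLeft = S :=
  Finset.toLeft_disjSum

theorem card_pad [Finite α] {S : Finset α} (hS : c.Feasible S) : (c.pad S).card = c.budget := by
  have := hS.card_le
  rw [pad, Finset.card_disjSum, Fin.card_filter_val_lt]
  omega

theorem extFeasible_pad [Finite α] {S : Finset α} (hS : c.Feasible S) : c.ExtFeasible (c.pad S) :=
  ⟨(c.pad_toLeft S).symm ▸ hS, (card_pad hS).le⟩

theorem expectedValue_run [Fintype α] (f : Finset α → ℝ)
    (x : OracleAlg (Finset α) c.Ext (Option (Finset α))) :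
    expectedValue f (x.run f) = x.expect f fun o => o.elim 0 f := by
  rw [← OracleAlg.sum_run_map_fst, Fintype.sum_option]
  simp [expectedValue]

variable [DecidableEq α] [Fintype α]

/-- The guarantee of the combined algorithm follows from a bound on guided random greedy for
guidance sets that are locally optimal and of small value. -/
theorem guarantee_of_meanAfter [Nonempty α] {f : Finset α → ℝ} {α₀ ε t R : ℝ} (hα₀ : 0 < α₀)
    (hf : IsSubmodular f) (hf0 : ∀ S, 0 ≤ f S) (hε : 0 < ε) (hk : 1 / ε ≤ (c.budget : ℝ))
    (H : ∀ (ρ : Rules c) (Z : Finset c.Ext) (O : Finset α), c.ExtFeasible Z →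
      Z.card = c.budget → c.Feasible O → 0 < f O → f (Z.toLeft ∩ O) ≤ (1 + ε) * f Z.toLeft →
      f (Z.toLeft ∩ O) + f (O ∪ Z.toLeft) ≤ (2 + ε) * f Z.toLeft →
      f Z.toLeft ≤ (R - ε) * f O → ε < R →
      (R - ε) * f O ≤ meanAfter ρ f t Z c.budget fun A => f A.toLeft) :
    c.Guarantee f α₀ ε t (R - ε) (3 / α₀ + 8) := by
  intro ρ Z₀ O hO hOmax hOpos hZ₀ hZ₀f
  have hk0 : (0 : ℝ) < c.budget := lt_of_lt_of_le (by positivity) hk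
  have hk0' : 0 < c.budget := by exact_mod_cast hk0
  -- By Bernoulli, (1 + ε/k)ᴺ ≥ 1 + Nε/k > 1/α₀, so `N` rounds would lift f(Z) above f(O).
  set N := ⌊(c.budget : ℝ) / (ε * α₀)⌋₊ + 1 with hN
  have hN1 : (c.budget : ℝ) / (ε * α₀) < N := by
    rw [hN]; push_cast; exact Nat.lt_floor_add_one _
  have hN2 : (N : ℝ) ≤ c.budget / (ε * α₀) + 1 := by
    rw [hN]; push_cast
    linarith [Nat.floor_le (show 0 ≤ (c.budget : ℝ) / (ε * α₀) by positivity)]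
  refine ⟨N, fun m hm => ?_⟩
  have hlt : f O < f (c.pad Z₀).toLeft * (1 + ε / c.budget) ^ N := by
    rw [pad_toLeft]
    have h0 : 0 < ε / c.budget := by positivity
    have h1 := one_add_mul_le_pow (a := ε / c.budget) (by linarith) N
    have h2 : 1 / α₀ < N * (ε / c.budget) := by
      rw [div_lt_iff₀ (by positivity)] at hN1 ⊢
      rw [show (N : ℝ) * (ε / c.budget) * α₀ = N * (ε * α₀) / c.budget by ring,
        lt_div_iff₀ hk0]
      linarith
    calc f O = α₀ * f O * (1 / α₀) := by field_simp
      _ < α₀ * f O * (1 + ε / c.budget) ^ N := by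
          gcongr
          linarith
      _ ≤ _ := by gcongr
  obtain ⟨Z, q, hZ, hZc, hZpos, hno, hq, hexp, halw⟩ := fastLS_spec ρ hf hε hk0' hOmax N m
    (c.pad Z₀) hm (extFeasible_pad hZ₀) (card_pad hZ₀)
    (by rw [pad_toLeft]; exact lt_of_lt_of_le (by positivity) hZ₀f) hlt
  have hRG := guidedRG_always ρ f (t := t) hZ hZc le_rfl
  constructor
  · refine (OracleAlg.always_iff_support f _ fun o n => (∃ S, o = some S ∧ c.Feasible S) ∧
      (ε ≤ 1 → (n : ℝ) ≤ (3 / α₀ + 8) * (c.budget * Fintype.card α / ε))).1 ?_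
    rw [localSearchGuidedGreedy, OracleAlg.always_bind, halw, OracleAlg.always_bind]
    refine hRG.mono ?_
    rintro _ n ⟨A, rfl, hA, hn⟩
    refine ⟨⟨_, rfl, ?_⟩, fun hε1 => ?_⟩
    · change c.Feasible (if f A.toLeft ≤ f Z.toLeft then Z.toLeft else A.toLeft)
      split_ifs
      exacts [hZ.1, hA.feasible.1]
    · have h2 : ({Z.toLeft, A.toLeft} : Finset (Finset α)).card ≤ 2 := Finset.card_le_two
      have hcount : 0 + ({Z.toLeft, A.toLeft} : Finset (Finset α)).card + n + q ≤
          2 + c.budget * (3 * Fintype.card α) + N * (3 * Fintype.card α) := by omega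
      have hcount' : ((0 + ({Z.toLeft, A.toLeft} : Finset (Finset α)).card + n + q : ℕ) : ℝ) ≤
          2 + c.budget * (3 * Fintype.card α) + N * (3 * Fintype.card α) := by
        exact_mod_cast hcount
      refine hcount'.trans ?_
      -- The 8 in the constant is 3 for guided greedy, 3 for the rounding of `N` and 2 for the final
      -- comparison.
      have hn1 : (1 : ℝ) ≤ Fintype.card α := by exact_mod_cast Fintype.card_pos (α := α)
      have hk1 : (1 : ℝ) ≤ c.budget := by exact_mod_cast hk0'
      have e1 : (Fintype.card α : ℝ) ≤ c.budget * Fintype.card α := by nlinarith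
      have e2 : (c.budget : ℝ) * Fintype.card α ≤ c.budget * Fintype.card α / ε := by
        rw [le_div_iff₀ hε]
        exact mul_le_of_le_one_right (by positivity) hε1
      have e3 : (N : ℝ) * (3 * Fintype.card α) ≤
          (c.budget / (ε * α₀) + 1) * (3 * Fintype.card α) := by gcongr
      have e4 : ((c.budget : ℝ) / (ε * α₀) + 1) * (3 * Fintype.card α) =
          3 / α₀ * (c.budget * Fintype.card α / ε) + 3 * Fintype.card α := by
        field_simp
      linarith
  · rw [expectedValue_run, localSearchGuidedGreedy, OracleAlg.expect_bind, hexp,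
      OracleAlg.expect_bind]
    have hbetter : ∀ A : Finset c.Ext, f Z.toLeft ≤
        (c.better Z A).expect f (fun o => o.elim 0 f) ∧
        f A.toLeft ≤ (c.better Z A).expect f fun o => o.elim 0 f := by
      intro A
      change f Z.toLeft ≤ f (if f A.toLeft ≤ f Z.toLeft then Z.toLeft else A.toLeft) ∧
        f A.toLeft ≤ f (if f A.toLeft ≤ f Z.toLeft then Z.toLeft else A.toLeft)
      split_ifs with h
      · exact ⟨le_rfl, h⟩
      · exact ⟨(not_le.1 h).le, le_rfl⟩
    by_cases hcase : (R - ε) * f O ≤ f Z.toLeft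
    · refine OracleAlg.le_expect (hRG.mono ?_)
      rintro _ n ⟨A, rfl, -⟩
      exact hcase.trans (hbetter A).1
    · have hεR : ε < R := by
        by_contra! h
        exact hcase ((mul_nonpos_of_nonpos_of_nonneg (by linarith) hOpos.le).trans (hf0 _))
      have hδ : (c.budget : ℝ) * (ε / c.budget * f Z.toLeft) = ε * f Z.toLeft := by field_simp
      have hδ0 : 0 ≤ ε / c.budget * f Z.toLeft := by positivity
      have hl1 := le_of_forall_not_isSwap hf hZ hZc hδ0 hno hO
      -- Local optimality against Z ∩ O itself, whose union with Z is Z.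
      have hl2 := le_of_forall_not_isSwap hf hZ hZc hδ0 hno
        (hO.mono (Finset.inter_subset_right (s₁ := Z.toLeft)))
      rw [hδ] at hl1 hl2
      rw [Finset.union_eq_right.2 Finset.inter_subset_left, ← Finset.inter_assoc,
        Finset.inter_self] at hl2
      refine (H ρ Z O hZ hZc hO hOpos (by linarith) (by linarith) (not_le.1 hcase).le hεR).trans ?_
      refine OracleAlg.expect_mono (hRG.mono ?_)
      rintro _ n ⟨A, rfl, -⟩
      exact (hbetter A).2

theorem exists_phases {t : ℝ} (ht0 : 0 ≤ t) (ht1 : t < 1) {k : ℕ} (hk : 0 < k) :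
    ∃ s n : ℕ, s + n = k ∧ 0 < n ∧ (s : ℝ) ≤ t * k ∧ t * k < s + 1 := by
  have hk0 : (0 : ℝ) < k := by exact_mod_cast hk
  have h1 := Nat.floor_le (show 0 ≤ t * k by positivity)
  have h2 : ⌊t * k⌋₊ < k := by
    have : (⌊t * k⌋₊ : ℝ) < k := by nlinarith
    exact_mod_cast this
  exact ⟨⌊t * k⌋₊, k - ⌊t * k⌋₊, by omega, by omega, h1, Nat.lt_floor_add_one _⟩

theorem size_guarantee [Nonempty α] {f : Finset α → ℝ} {α₀ ε : ℝ} (hα₀ : 0 < α₀)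
    (hf : IsSubmodular f) (hf0 : ∀ S, 0 ≤ f S) (hε : 0 < ε) {k : ℕ} (hk : 1 / ε ≤ (k : ℝ)) :
    (size k : Constraint α).Guarantee f α₀ ε 0.372 (0.385 - ε) (3 / α₀ + 8) := by
  refine guarantee_of_meanAfter hα₀ hf hf0 hε hk ?_
  intro ρ Z O hZ hZc hO hOpos hW hWY hv hεR
  have hk0 : (0 : ℝ) < k := lt_of_lt_of_le (by positivity) hk
  have hk0' : 0 < k := by exact_mod_cast hk0
  have hkε : (k : ℝ)⁻¹ ≤ ε := inv_le_of_inv_le₀ hε (by rwa [← one_div])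
  obtain ⟨s, n, hsn, hn, hs, hs'⟩ := exists_phases (t := 0.372) (by norm_num) (by norm_num) hk0'
  set r : ℝ := 1 - 1 / k with hr
  have hr0 : 0 < r := by rw [hr, one_div]; linarith
  have hr1 : r ≤ 1 := by rw [hr, one_div]; linarith [inv_pos.2 hk0]
  obtain ⟨h1, h2, h3⟩ := size_two_phase_bound hsn hn hs hs' hkε hεR.le hr
  have hu := two_phase_le_meanAfter ρ hf hf0 hZ hZc hO hsn hs hs'
    (l := 1) (by simp [lossFactor]) hr hr0 hk0'
  have hX := hf.sub_inter_le_sdiff hf0 O Z.toLeft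
  -- The coefficient of f(O \ Z) is nonnegative, so f(O \ Z) may be replaced by its lower bound f(O)
  -- − f(Z ∩ O).
  have hc : 0 ≤ r ^ n * (1 - r ^ s) :=
    mul_nonneg (by positivity) (sub_nonneg.2 (pow_le_one₀ hr0.le hr1))
  refine le_of_local_optimum ?_ le_rfl h1 h2 (hf0 _) hOpos.le hε.le hW hWY hv h3
  refine le_trans ?_ hu
  have := mul_le_mul_of_nonneg_left hX hc
  have hb : ((size k : Constraint α).budget : ℝ) = k := rfl
  rw [hb]
  clear_value r
  linear_combination this

theorem matroid_guarantee [Nonempty α] {f : Finset α → ℝ} {α₀ ε : ℝ} (hα₀ : 0 < α₀)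
    (hf : IsSubmodular f) (hf0 : ∀ S, 0 ≤ f S) (hε : 0 < ε) {M : Matroid α}
    (hk : 1 / ε ≤ ((matroid M).budget : ℝ)) :
    (matroid M).Guarantee f α₀ ε 0.559 (0.305 - ε) (3 / α₀ + 8) := by
  refine guarantee_of_meanAfter hα₀ hf hf0 hε hk ?_
  intro ρ Z O hZ hZc hO hOpos hW hWY hv hεR
  set k := (matroid M).budget with hkdef
  have hk0 : (0 : ℝ) < k := lt_of_lt_of_le (by positivity) hk
  have hk0' : 0 < k := by exact_mod_cast hk0
  have hkε : (k : ℝ)⁻¹ ≤ ε := inv_le_of_inv_le₀ hε (by rwa [← one_div])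
  obtain ⟨s, n, hsn, hn, hs, hs'⟩ := exists_phases (t := 0.559) (by norm_num) (by norm_num) hk0'
  set r : ℝ := 1 - 2 / k with hr
  have hr0 : 0 < r := by rw [hr, div_eq_mul_inv]; linarith
  have hr1 : r ≤ 1 := by rw [hr, div_eq_mul_inv]; linarith [inv_pos.2 hk0]
  obtain ⟨h1, h2, h3, h4⟩ := matroid_two_phase_bound hsn hn hs hs' hkε hεR.le hr
  have hu := two_phase_le_meanAfter ρ hf hf0 hZ hZc hO hsn hs hs'
    (l := 2) (by norm_num [lossFactor]) hr hr0 hk0'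
  have hX := hf.sub_inter_le_sdiff hf0 O Z.toLeft
  have hc : 0 ≤ r ^ n * (1 - r ^ s) / 2 :=
    div_nonneg (mul_nonneg (by positivity) (sub_nonneg.2 (pow_le_one₀ hr0.le hr1))) zero_le_two
  refine le_of_local_optimum ?_ h1 h2 h3 (hf0 _) hOpos.le hε.le hW hWY hv h4
  refine le_trans ?_ hu
  have := mul_le_mul_of_nonneg_left hX hc
  linear_combination this

end Constraint

theorem theorem1 (α₀ : ℝ) (hα₀ : 0 < α₀) :
    ∃ C : ℝ, ∀ (α : Type u) [Fintype α] [DecidableEq α] [Nonempty α] (f : Finset α → ℝ) (ε : ℝ),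
      IsSubmodular f → (∀ S, 0 ≤ f S) → 0 < ε →
        (∀ k : ℕ, 1 / ε ≤ (k : ℝ) →
          (Constraint.size k).Guarantee f α₀ ε 0.372 (0.385 - ε) C) ∧
        (∀ M : Matroid α, M.E = Set.univ → 1 / ε ≤ ((Constraint.matroid M).budget : ℝ) →
          (Constraint.matroid M).Guarantee f α₀ ε 0.559 (0.305 - ε) C) := by
  refine ⟨3 / α₀ + 8, fun α _ _ _ f ε hf hf0 hε => ⟨fun k hk => ?_, fun M _ hk => ?_⟩⟩
  · exact Constraint.size_guarantee hα₀ hf hf0 hε hk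
  · exact Constraint.matroid_guarantee hα₀ hf hf0 hε hk
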